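/- Let $X$ be a real Hilbert space, let $N\ge 1$, and for $j=1,\dots,N$ let $(\tau_n^j)_{n\in\mathbb N}$ be sequences of surjective linear isometries of $X$; write $\tau_n^{k/j}=\tau_n^k(\tau_n^j)^{-1}$. Let $A$, $B^j$ ($j=1,\dots,N$) and $R_n$ ($n\in\mathbb N$) be (possibly unbounded) linear operators in $X$, and put $$B_n^j=(\tau_n^j)^{-1}B^j\tau_n^j,\qquad L_n=A+\sum_{j=1}^N B_n^j+R_n .$$ Here sums of operators are defined on the intersection of the domains; $\rho$ and $\sigma$ denote resolvent set and spectrum. Assume: * (A1) For all $j,n$ the operators $A$, $A+B^j$, $A+B^j_n$, $L_n$ are self-adjoint with the same domain $D(A)$. * (A2) $A$ is invertible (with bounded inverse), and $A=(\tau_n^j)^{-1}A\tau_n^j$ for all $j,n$. * (A3) There is $\delta>0$ such that for all $j,n$ the spectra of $A$, $A+B^j$, $A+B^j_n$, $L_n$ in $(-\infty,\delta)$ consist of finitely many eigenvalues with finite geometric multiplicities. * (A4) For every real $\lambda\in\bigcap_{k=1}^N\rho(A+B^k)$ and all $j$, the operator $A(A+B^j-\lambda I)^{-1}$ is bounded.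 * (A5) $\|R_nA^{-1}\|\to0$ in the operator norm as $n\to\infty$. * (A6) For all $u\in D(A)$ and all $j\ne l$, $\|\tau_n^{j/l}B^l\tau_n^{l/j}u\|_X\to0$ as $n\to\infty$. * (A7) For all $u\in X$ and all $j\ne k$, $\tau_n^{j/k}u\rightharpoonup0$ weakly in $X$ as $n\to\infty$. * (A8) For all $j$, the operator $B^jA^{-1}$ is compact. For a self-adjoint operator $L$ whose spectrum in $(-\infty,\delta)$ consists, for some $\delta>0$, of finitely many eigenvalues with finite geometric multiplicities, let $\operatorname{in}(L)=(m,z)$, where $m$ is the number of negative eigenvalues of $L$ counted with geometric multiplicities and $z=\dim\ker L$. Suppose that there is $n_L\in\mathbb N$ such that for all $n\ge n_L$ $$\dim\ker L_n\ \ge\ \sum_{j=1}^N\dim\ker(A+B^j).$$ Then there is $n_0\ge n_L$ such that for all $n\ge n_0$ $$\operatorname{in}(L_n)=\sum_{j=1}^N\operatorname{in}(A+B^j),$$ the sum of pairs being taken componentwise. Moreover, a non-zero eigenvalue of $L_n$ cannot approach $0$ as $n\to\infty$: there are $\varepsilon>0$ and $n_0\ge n_L$ such that for all $n\ge n_0$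 every non-zero eigenvalue $\mu$ of $L_n$ satisfies $|\mu|\ge\varepsilon$. -/

import Mathlib

open Filter Topology

noncomputable section

/-! Unbounded operators on a real Hilbert space `X` are partially defined linear maps
`X →ₗ.[ℝ] X`; sums of such maps are defined on the intersection of the domains. -/

namespace IsoInertia

variable {X : Type*} [NormedAddCommGroup X] [InnerProductSpace ℝ X]

/-- The operator `L - c I`, with the domain of `L`. -/
def shift (L : X →ₗ.[ℝ] X) (c : ℝ) : X →ₗ.[ℝ] X :=
  (-(c • (LinearMap.id : X →ₗ[ℝ] X))) +ᵥ L

/-- The operator `τ⁻¹ T τ`, with its natural domain `{u | τ u ∈ D(T)}`. -/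
def conj (τ : X ≃ₗᵢ[ℝ] X) (T : X →ₗ.[ℝ] X) : X →ₗ.[ℝ] X where
  domain := T.domain.comap τ.toLinearEquiv.toLinearMap
  toFun := τ.symm.toLinearEquiv.toLinearMap ∘ₗ T.toFun ∘ₗ
    τ.toLinearEquiv.toLinearMap.restrict (fun _ hx => hx)

/-- `IsBoundedQuotient T S K`: the bounded operator `K` is `T S⁻¹`. It is used for operators `S`
that map `D(S)` bijectively onto `X`, where it determines `K`. -/
def IsBoundedQuotient (T S : X →ₗ.[ℝ] X) (K : X →L[ℝ] X) : Prop :=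
  ∀ u : S.domain, ∃ h : (u : X) ∈ T.domain, T ⟨u, h⟩ = K (S u)

/-- The (real) resolvent set of `L`: those `c` for which `L - c I : D(L) → X` has a bounded
two-sided inverse `X → D(L)`. -/
def resolventSet (L : X →ₗ.[ℝ] X) : Set ℝ :=
  {c | ∃ R : X →L[ℝ] X,
    (∀ x : X, ∃ h : R x ∈ (shift L c).domain, shift L c ⟨R x, h⟩ = x) ∧
    (∀ u : (shift L c).domain, R (shift L c u) = u)}

/-- The spectrum of `L` (for a self-adjoint operator it is contained in the real line). -/
def spec (L : X →ₗ.[ℝ] X) : Set ℝ := (resolventSet L)ᶜ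

/-- The kernel of `L - c I`, i.e. the set of `u ∈ D(L)` with `L u = c u`. -/
def eigenspace (L : X →ₗ.[ℝ] X) (c : ℝ) : Submodule ℝ X :=
  L.graph.comap (LinearMap.prod LinearMap.id (c • LinearMap.id))

/-- `c` is an eigenvalue of `L`. -/
def IsEigenvalue (L : X →ₗ.[ℝ] X) (c : ℝ) : Prop := eigenspace L c ≠ ⊥

/-- The kernel of `L`. -/
def ker (L : X →ₗ.[ℝ] X) : Submodule ℝ X := eigenspace L 0

/-- The spectrum of `L` in `(-∞, δ)` consists of finitely many eigenvalues with finite geometric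
multiplicities. -/
def DiscreteBelow (L : X →ₗ.[ℝ] X) (δ : ℝ) : Prop :=
  (spec L ∩ Set.Iio δ).Finite ∧
    ∀ c ∈ spec L ∩ Set.Iio δ, IsEigenvalue L c ∧ FiniteDimensional ℝ (eigenspace L c)

/-- The inertia of `L`: the number of negative eigenvalues counted with geometric multiplicities,
and the dimension of the kernel. It is meaningful when `DiscreteBelow L δ` for some `δ > 0`. -/
def inertia (L : X →ₗ.[ℝ] X) : ℕ × ℕ :=
  (∑ᶠ c ∈ Set.Iio (0 : ℝ), Module.finrank ℝ (eigenspace L c), Module.finrank ℝ (ker L))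

/-- The isometry `τ_n^{k/j} = τ_n^k (τ_n^j)⁻¹`. -/
def ratio {N : ℕ} (τ : Fin N → ℕ → X ≃ₗᵢ[ℝ] X) (n : ℕ) (k j : Fin N) : X ≃ₗᵢ[ℝ] X :=
  τ k n * (τ j n)⁻¹

/-- The operator `B_n^j = (τ_n^j)⁻¹ B^j τ_n^j`. -/
def Bn {N : ℕ} (B : Fin N → X →ₗ.[ℝ] X) (τ : Fin N → ℕ → X ≃ₗᵢ[ℝ] X) (j : Fin N) (n : ℕ) :
    X →ₗ.[ℝ] X :=
  conj (τ j n) (B j)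

/-- The operator `L_n = A + ∑ j, B_n^j + R_n`. -/
def Ln {N : ℕ} (A : X →ₗ.[ℝ] X) (B : Fin N → X →ₗ.[ℝ] X) (R : ℕ → X →ₗ.[ℝ] X)
    (τ : Fin N → ℕ → X ≃ₗᵢ[ℝ] X) (n : ℕ) : X →ₗ.[ℝ] X :=
  A + ∑ j, Bn B τ j n + R n

/-- `L` is self-adjoint and its domain is `D(A)`. -/
def IsSelfAdjointOn [CompleteSpace X] (A L : X →ₗ.[ℝ] X) : Prop :=
  IsSelfAdjoint L ∧ L.domain = A.domain

/-- The standing assumptions on `A`, the `B^j`, the `R_n` and the isometries `τ_n^j`. -/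
structure Assumptions [CompleteSpace X] {N : ℕ} (A : X →ₗ.[ℝ] X) (B : Fin N → X →ₗ.[ℝ] X)
    (R : ℕ → X →ₗ.[ℝ] X) (τ : Fin N → ℕ → X ≃ₗᵢ[ℝ] X) : Prop where
  /-- All the operators are self-adjoint with the same domain `D(A)`. -/
  selfAdjoint_A : IsSelfAdjoint A
  selfAdjoint_B : ∀ j, IsSelfAdjointOn A (A + B j)
  selfAdjoint_Bn : ∀ j n, IsSelfAdjointOn A (A + Bn B τ j n)
  selfAdjoint_L : ∀ n, IsSelfAdjointOn A (Ln A B R τ n)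
  /-- `A` is invertible and commutes with the `τ_n^j`. -/
  invertible : (0 : ℝ) ∈ resolventSet A
  commutes : ∀ j n, conj (τ j n) A = A
  /-- The spectra below a common `δ > 0` are finite sets of eigenvalues with finite
  geometric multiplicities. -/
  discrete : ∃ δ : ℝ, 0 < δ ∧ DiscreteBelow A δ ∧ (∀ j, DiscreteBelow (A + B j) δ) ∧
    (∀ j n, DiscreteBelow (A + Bn B τ j n) δ) ∧ ∀ n, DiscreteBelow (Ln A B R τ n) δ
  /-- The operators `A (A + B^j - c I)⁻¹` are bounded. -/
  bounded : ∀ c : ℝ, (∀ k, c ∈ resolventSet (A + B k)) →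
    ∀ j, ∃ K : X →L[ℝ] X, IsBoundedQuotient A (shift (A + B j) c) K
  /-- `‖R_n A⁻¹‖ → 0` in the operator norm. -/
  remainder : ∃ K : ℕ → X →L[ℝ] X, (∀ n, IsBoundedQuotient (R n) A (K n)) ∧
    Tendsto (fun n => ‖K n‖) atTop (𝓝 0)
  /-- `τ_n^{j/l} B^l τ_n^{l/j} u → 0` for every `u ∈ D(A)` and `j ≠ l`. -/
  decoupling : ∀ u ∈ A.domain, ∀ j l, j ≠ l →
    ∃ h : ∀ n, u ∈ (conj (ratio τ n l j) (B l)).domain,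
      Tendsto (fun n => ‖conj (ratio τ n l j) (B l) ⟨u, h n⟩‖) atTop (𝓝 0)
  /-- `τ_n^{j/k} u` converges weakly to `0` for every `u ∈ X` and `j ≠ k`. -/
  weak : ∀ u : X, ∀ j k, j ≠ k →
    ∀ v : X, Tendsto (fun n => inner ℝ (ratio τ n j k u) v) atTop (𝓝 0)
  /-- `B^j A⁻¹` is compact. -/
  compact : ∀ j, ∃ K : X →L[ℝ] X, IsBoundedQuotient (B j) A K ∧ IsCompactOperator K

end IsoInertia

end

/-!
The eigenvalues of `L_n` in `(-∞, ε]` are compared with the eigenvalues of the operators `A + B^j`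
in `(-∞, 0]`, for an `ε > 0` such that the `A + B^j` have no eigenvalues within `2 ε` of `0` other
than `0` itself. Let `m` be the number of negative eigenvalues of all the `A + B^j` together, and
`z` the sum of the dimensions of their kernels.

* `BoundedModel.eventually_eigenvalueCount_le`: for large `n`, `L_n` has at most `m + z` eigenvalues
  in `(-∞, ε]`. Otherwise there are `m + z + 1` orthonormal eigenvectors for infinitely many `n`.
  By `BoundedModel.exists_profile` each of them is asymptotically a sum of translates
  `(τ_n^j)⁻¹ w^j`, where the `w^j` are eigenvectors of `A + B^j` for a common limit
  eigenvalue. Since the translates decouple, the tuples `(w^j)_j` are orthonormal in `⊕ j, X`, which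
  is impossible for dimensional reasons.
* `BoundedModel.eventually_le_eigenvalueCount`: for large `n`, `L_n` has at least `m` eigenvalues
  below `-ε`. The translates of the negative eigenvectors of the `A + B^j` are almost orthonormal
  approximate eigenvectors of `L_n`, so they span a space on which
  the form of `L_n` is too negative.

With the hypothesis `z ≤ dim ker L_n`, all these inequalities are equalities, so that `L_n` has
no eigenvalues in `[-ε, 0)` or `(0, ε]`.

The profile decomposition rests on two facts. The operators `B^j A⁻¹` are compact, so that
`B_n^j u_n` only sees the weak limit of `τ_n^j u_n`; and `A ≥ δ` up to a form of finite rank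
(`exists_le_inner_add_sum`), so that a remainder that tends weakly to zero and is
asymptotically annihilated by `A - ν` with `ν < δ` tends to zero in norm. Limits are
taken along ultrafilters instead of subsequences.

The form bounds for operators with discrete spectrum below `δ` are obtained without the spectral
theorem, from the Rayleigh principle for a resolvent (`le_inner_of_orthogonal_eigenspaces`).
-/

open Filter Topology

noncomputable section

namespace IsoInertia

/-! ### Bounded symmetric operators -/

section

variable {X : Type*} [NormedAddCommGroup X] [InnerProductSpace ℝ X]

/-- **Rayleigh principle**: the infimum of the numerical range of a bounded symmetric operator on
an invariant subspace `V` is an approximate eigenvalue. So if `S - m` is bounded below on `V` for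
every `m < a`, the quadratic form of `S` is at least `a` on `V`. -/
theorem le_inner_of_boundedBelow {S : X →L[ℝ] X} (hS : ∀ x y, inner ℝ (S x) y = inner ℝ x (S y))
    (V : Submodule ℝ X) (hV : ∀ x ∈ V, S x ∈ V) (a : ℝ)
    (h : ∀ m < a, ∃ k > 0, ∀ x ∈ V, k * ‖x‖ ≤ ‖S x - m • x‖) :
    ∀ x ∈ V, a * ‖x‖ ^ 2 ≤ inner ℝ (S x) x := by
  set q : Set ℝ := {t | ∃ x ∈ V, ‖x‖ = 1 ∧ t = inner ℝ (S x) x} with hq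
  have hbdd : ∀ x : X, ‖x‖ = 1 → -‖S‖ ≤ inner ℝ (S x) x := by
    intro x hx
    have h1 := abs_real_inner_le_norm (S x) x
    have h2 := S.le_opNorm x
    rw [hx, mul_one] at h1 h2
    linarith [neg_abs_le (inner ℝ (S x) x)]
  have hqb : BddBelow q := ⟨-‖S‖, by rintro t ⟨x, _, hx, rfl⟩; exact hbdd x hx⟩
  have hnormalize : ∀ x ∈ V, x ≠ 0 → inner ℝ (S (‖x‖⁻¹ • x)) (‖x‖⁻¹ • x) ∈ q := fun x hx hx0 =>
    ⟨_, V.smul_mem _ hx, by rw [norm_smul, norm_inv, norm_norm, inv_mul_cancel₀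
      (norm_ne_zero_iff.2 hx0)], rfl⟩
  have hunit : ∀ x ∈ V, sInf q * ‖x‖ ^ 2 ≤ inner ℝ (S x) x := by
    intro x hx
    rcases eq_or_ne x 0 with rfl | hx0
    · simp
    have hn : 0 < ‖x‖ := norm_pos_iff.2 hx0
    have := csInf_le hqb (hnormalize x hx hx0)
    rw [map_smul, real_inner_smul_left, real_inner_smul_right, ← mul_assoc] at this
    calc sInf q * ‖x‖ ^ 2 ≤ (‖x‖⁻¹ * ‖x‖⁻¹ * inner ℝ (S x) x) * ‖x‖ ^ 2 := by gcongr
      _ = inner ℝ (S x) x := by field_simp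
  suffices hsuff : a ≤ sInf q ∨ q = ∅ by
    intro x hx
    rcases hsuff with h1 | h1
    · exact (mul_le_mul_of_nonneg_right h1 (sq_nonneg _)).trans (hunit x hx)
    · rcases eq_or_ne x 0 with rfl | hx0
      · simp
      have hm := hnormalize x hx hx0
      rw [h1] at hm
      exact hm.elim
  by_contra! hcon
  obtain ⟨hlt, hne⟩ := hcon
  obtain ⟨k, hk, hkb⟩ := h _ hlt
  set m := sInf q with hm
  -- `Z = S - m` is a nonnegative operator on `V`, so `‖Z x‖² ≤ ‖Z‖ ⟨Z x, x⟩` there.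
  set Z : X →L[ℝ] X := S - m • ContinuousLinearMap.id ℝ X with hZ
  have hZa : ∀ x, Z x = S x - m • x := fun x => by simp [hZ]
  have hZs : ∀ x y, inner ℝ (Z x) y = inner ℝ x (Z y) := by
    intro x y
    simp only [hZa, inner_sub_left, inner_sub_right, hS, real_inner_smul_left,
      real_inner_smul_right]
  have hZV : ∀ x ∈ V, Z x ∈ V := fun x hx => by
    rw [hZa]; exact V.sub_mem (hV x hx) (V.smul_mem _ hx)
  have hZp : ∀ x ∈ V, 0 ≤ inner ℝ (Z x) x := fun x hx => by
    have := hunit x hx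
    rw [hZa, inner_sub_left, real_inner_smul_left, real_inner_self_eq_norm_sq]
    linarith
  have hCS : ∀ x ∈ V, ‖Z x‖ ^ 2 ≤ (‖Z‖ + 1) * inner ℝ (Z x) x := by
    intro x hx
    set c := ‖Z‖ + 1 with hc
    have hc0 : 0 < c := by positivity
    have hp := hZp (x - c⁻¹ • Z x) (V.sub_mem hx (V.smul_mem _ (hZV x hx)))
    have hzz : inner ℝ (Z (Z x)) (Z x) ≤ c * ‖Z x‖ ^ 2 := by
      have h1 := real_inner_le_norm (Z (Z x)) (Z x)
      have h2 := Z.le_opNorm (Z x)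
      nlinarith [norm_nonneg (Z x), norm_nonneg (Z (Z x)), sq_nonneg ‖Z x‖]
    have e : inner ℝ (Z (x - c⁻¹ • Z x)) (x - c⁻¹ • Z x) =
        inner ℝ (Z x) x - 2 * c⁻¹ * ‖Z x‖ ^ 2 + c⁻¹ * c⁻¹ * inner ℝ (Z (Z x)) (Z x) := by
      simp only [map_sub, map_smul, inner_sub_left, inner_sub_right, real_inner_smul_left,
        real_inner_smul_right]
      rw [hZs (Z x) x, real_inner_self_eq_norm_sq]
      ring
    rw [e] at hp
    have h3 : c⁻¹ * c⁻¹ * inner ℝ (Z (Z x)) (Z x) ≤ c⁻¹ * ‖Z x‖ ^ 2 := by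
      calc c⁻¹ * c⁻¹ * inner ℝ (Z (Z x)) (Z x) ≤ c⁻¹ * c⁻¹ * (c * ‖Z x‖ ^ 2) := by gcongr
        _ = c⁻¹ * ‖Z x‖ ^ 2 := by field_simp
    have h4 : c⁻¹ * ‖Z x‖ ^ 2 ≤ inner ℝ (Z x) x := by linarith
    calc ‖Z x‖ ^ 2 = c * (c⁻¹ * ‖Z x‖ ^ 2) := by field_simp
      _ ≤ _ := by gcongr
  have hc0 : 0 < ‖Z‖ + 1 := by positivity
  obtain ⟨t, ⟨x, hxV, hx1, rfl⟩, hlt'⟩ := exists_lt_of_csInf_lt hne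
    (show sInf q < m + k ^ 2 / (‖Z‖ + 1) by
      linarith [show 0 < k ^ 2 / (‖Z‖ + 1) by positivity])
  have h1 := hkb x hxV
  rw [hx1, mul_one, ← hZa] at h1
  have h2 := hCS x hxV
  have h3 : inner ℝ (Z x) x < k ^ 2 / (‖Z‖ + 1) := by
    rw [hZa, inner_sub_left, real_inner_smul_left, real_inner_self_eq_norm_sq, hx1]
    linarith
  have h4 : (‖Z‖ + 1) * inner ℝ (Z x) x < k ^ 2 := by
    rw [lt_div_iff₀ hc0] at h3; linarith
  nlinarith

/-- If `s` is a bounded symmetric operator and `s - t` is bounded below for `0 < |t| < r`, then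
`s` is bounded below by `r` on the orthogonal complement of its kernel: `0` is at most an isolated
point of the spectrum. Since the range of `s` is dense in this complement, the claim is
`⟨s² x, (s² - r²) x⟩ ≥ 0`, and this follows from the Rayleigh principle, because
`s⁴ - r² s² - m` is bounded below for every `m < 0`. -/
theorem norm_le_of_isolated [CompleteSpace X] {s : X →L[ℝ] X}
    (hs : ∀ x y, inner ℝ (s x) y = inner ℝ x (s y)) {r : ℝ} (hr : 0 < r)
    (h : ∀ t : ℝ, t ≠ 0 → |t| < r → ∃ k > 0, ∀ x, k * ‖x‖ ≤ ‖s x - t • x‖)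
    {x : X} (hx : ∀ v, s v = 0 → inner ℝ v x = 0) : r * ‖x‖ ≤ ‖s x‖ := by
  have hW : ∀ y : ℝ, 0 < y → y < r ^ 2 →
      ∃ k > 0, ∀ x, k * ‖x‖ ≤ ‖s (s x) - y • x‖ := by
    intro y hy hyr
    have hsq : 0 < √y := Real.sqrt_pos.2 hy
    have hsr : √y < r := (Real.sqrt_lt' hr).2 hyr
    obtain ⟨k, hk, hkb⟩ := h (√y) hsq.ne' (by rwa [abs_of_pos hsq])
    obtain ⟨k', hk', hkb'⟩ := h (-√y) (neg_neg_of_pos hsq).ne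
      (by rwa [abs_neg, abs_of_pos hsq])
    refine ⟨k * k', mul_pos hk hk', fun x => ?_⟩
    have e : s (s x) - y • x = s (s x - (-√y) • x) - √y • (s x - (-√y) • x) := by
      rw [map_sub, map_smul, smul_sub, smul_smul, mul_neg, Real.mul_self_sqrt hy.le]
      module
    rw [e]
    calc k * k' * ‖x‖ = k * (k' * ‖x‖) := by ring
      _ ≤ k * ‖s x - (-√y) • x‖ := by gcongr; exact hkb' x
      _ ≤ _ := hkb _
  set Q : X →L[ℝ] X := (s ∘L s) ∘L (s ∘L s) - r ^ 2 • (s ∘L s) with hQ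
  have hQa : ∀ x, Q x = s (s (s (s x))) - r ^ 2 • s (s x) := fun x => by simp [hQ]
  have hpos : ∀ x, 0 ≤ inner ℝ (Q x) x := by
    intro x
    have := le_inner_of_boundedBelow (S := Q) (fun x y => by
      simp only [hQa, inner_sub_left, inner_sub_right, hs, real_inner_smul_left,
        real_inner_smul_right]) ⊤ (fun _ _ => trivial) 0 ?_ x trivial
    · simpa using this
    intro m hm
    -- `t⁴ - r² t² - m` is a product of two factors `t² - y` with `0 < y < r²`, or is positive
    rcases le_or_gt 0 (r ^ 4 / 4 + m) with hd | hd
    · set D := √(r ^ 4 / 4 + m) with hD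
      have hDD : D * D = r ^ 4 / 4 + m := Real.mul_self_sqrt hd
      have hD0 : 0 ≤ D := Real.sqrt_nonneg _
      have hDr : D < r ^ 2 / 2 := (Real.sqrt_lt' (by positivity)).2 (by nlinarith)
      obtain ⟨k, hk, hkb⟩ := hW (r ^ 2 / 2 + D) (by positivity) (by linarith)
      obtain ⟨k', hk', hkb'⟩ := hW (r ^ 2 / 2 - D) (by linarith) (by nlinarith)
      refine ⟨k * k', mul_pos hk hk', fun x _ => ?_⟩
      have e : Q x - m • x = s (s (s (s x) - (r ^ 2 / 2 - D) • x)) -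
          (r ^ 2 / 2 + D) • (s (s x) - (r ^ 2 / 2 - D) • x) := by
        have hmm : m = D * D - r ^ 4 / 4 := by linarith
        rw [hQa, hmm]
        simp only [map_sub, map_smul]
        module
      rw [e]
      calc k * k' * ‖x‖ = k * (k' * ‖x‖) := by ring
        _ ≤ k * ‖s (s x) - (r ^ 2 / 2 - D) • x‖ := by gcongr; exact hkb' x
        _ ≤ _ := hkb _
    · refine ⟨-(r ^ 4 / 4 + m), by linarith, fun x _ => ?_⟩
      set κ := -(r ^ 4 / 4 + m) with hκ
      rcases eq_or_ne x 0 with rfl | hx0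
      · simp
      have hn : 0 < ‖x‖ := norm_pos_iff.2 hx0
      have e : inner ℝ (Q x - m • x) x = ‖s (s x) - (r ^ 2 / 2) • x‖ ^ 2 + κ * ‖x‖ ^ 2 := by
        rw [← real_inner_self_eq_norm_sq, ← real_inner_self_eq_norm_sq, hQa]
        simp only [inner_sub_left, inner_sub_right, real_inner_smul_left,
          real_inner_smul_right]
        rw [hs (s (s (s x))) x, hs (s (s x)) (s x), hs (s x) x, hs x (s x), hκ]
        rw [real_inner_comm (s (s x)) x]
        have : inner ℝ (s (s x)) x = inner ℝ x (s (s x)) := real_inner_comm _ _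
        ring_nf
      have h1 := real_inner_le_norm (Q x - m • x) x
      rw [e] at h1
      have h2 : κ * ‖x‖ * ‖x‖ ≤ ‖Q x - m • x‖ * ‖x‖ := by
        nlinarith [sq_nonneg ‖s (s x) - (r ^ 2 / 2) • x‖]
      exact le_of_mul_le_mul_right h2 hn
  have hrange : ∀ z, r * ‖s z‖ ≤ ‖s (s z)‖ := by
    intro z
    have h1 := hpos z
    rw [hQa, inner_sub_left, real_inner_smul_left, hs, hs, hs (s z) z,
      real_inner_self_eq_norm_sq, real_inner_self_eq_norm_sq] at h1
    refine le_of_sq_le_sq ?_ (norm_nonneg _)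
    rw [mul_pow]; linarith
  have hmem : x ∈ s.range.topologicalClosure := by
    rw [← Submodule.orthogonal_orthogonal_eq_closure]
    intro v hv
    apply hx
    have h0 : inner ℝ (s (s v)) v = 0 := hv _ ⟨s v, rfl⟩
    rw [hs, real_inner_self_eq_norm_sq] at h0
    simpa using h0
  have hcl : IsClosed {x : X | r * ‖x‖ ≤ ‖s x‖} :=
    isClosed_le (by fun_prop) (by fun_prop)
  exact closure_minimal (by rintro _ ⟨z, rfl⟩; exact hrange z) hcl hmem

end

/-! ### Symmetric operators with discrete spectrum below a threshold -/

section

variable {X : Type*} [NormedAddCommGroup X] [InnerProductSpace ℝ X]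

/-- `L` is symmetric, expressed through its graph. -/
def GraphSymmetric (L : X →ₗ.[ℝ] X) : Prop :=
  ∀ p ∈ L.graph, ∀ q ∈ L.graph, inner ℝ p.2 q.1 = inner ℝ p.1 q.2

theorem graphSymmetric_of_isSelfAdjoint [CompleteSpace X] {L : X →ₗ.[ℝ] X}
    (hL : IsSelfAdjoint L) : GraphSymmetric L := by
  have h := LinearPMap.adjoint_isFormalAdjoint hL.dense_domain
  rw [LinearPMap.isSelfAdjoint_def.1 hL] at h
  intro p hp q hq
  obtain ⟨a, ha, ha'⟩ := (LinearPMap.mem_graph_iff L).1 hp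
  obtain ⟨b, hb, hb'⟩ := (LinearPMap.mem_graph_iff L).1 hq
  rw [← ha, ← ha', ← hb, ← hb']
  exact h a b

theorem mem_eigenspace_iff {L : X →ₗ.[ℝ] X} {c : ℝ} {u : X} :
    u ∈ eigenspace L c ↔ (u, c • u) ∈ L.graph := Iff.rfl

theorem mem_resolventSet_iff {L : X →ₗ.[ℝ] X} {c : ℝ} : c ∈ resolventSet L ↔
    ∃ T : X →L[ℝ] X, (∀ x, (T x, x + c • T x) ∈ L.graph) ∧
      ∀ p ∈ L.graph, T (p.2 - c • p.1) = p.1 := by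
  have key : ∀ u : L.domain, shift L c u = L u - c • (u : X) := by
    intro u
    have : shift L c u = (-(c • (LinearMap.id : X →ₗ[ℝ] X))) (u : X) + L u := rfl
    rw [this]; simp [sub_eq_neg_add]
  constructor
  · rintro ⟨T, h1, h2⟩
    refine ⟨T, fun x => ?_, fun p hp => ?_⟩
    · obtain ⟨h, hx⟩ := h1 x
      rw [LinearPMap.mem_graph_iff]
      refine ⟨⟨T x, h⟩, rfl, ?_⟩
      exact (sub_eq_iff_eq_add.1 ((key ⟨T x, h⟩).symm.trans hx))
    · obtain ⟨u, hu, hu'⟩ := (LinearPMap.mem_graph_iff L).1 hp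
      rw [← hu, ← hu', ← key u]
      exact h2 u
  · rintro ⟨T, h1, h2⟩
    refine ⟨T, fun x => ?_, fun u => ?_⟩
    · obtain ⟨u, hu, hu'⟩ := (LinearPMap.mem_graph_iff L).1 (h1 x)
      dsimp only at hu hu'
      have hm : T x ∈ L.domain := hu ▸ u.2
      refine ⟨hm, ?_⟩
      have e : (⟨T x, hm⟩ : L.domain) = u := Subtype.ext hu.symm
      refine (key ⟨T x, hm⟩).trans ?_
      rw [e, hu', hu]
      exact add_sub_cancel_right _ _
    · have := h2 _ (L.mem_graph u)
      rw [← key u] at this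
      exact this

theorem eigenspace_eq_bot_of_mem_resolventSet {L : X →ₗ.[ℝ] X} {c : ℝ}
    (hc : c ∈ resolventSet L) : eigenspace L c = ⊥ := by
  obtain ⟨T, -, h2⟩ := mem_resolventSet_iff.1 hc
  rw [Submodule.eq_bot_iff]
  intro u hu
  simpa using (h2 _ hu).symm

theorem inner_eq_zero_of_mem_eigenspace {L : X →ₗ.[ℝ] X} (hsym : GraphSymmetric L) {c d : ℝ}
    (hcd : c ≠ d) {u v : X} (hu : u ∈ eigenspace L c) (hv : v ∈ eigenspace L d) :
    inner ℝ u v = 0 := by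
  have h : inner ℝ (c • u) v = inner ℝ u (d • v) := hsym _ hu _ hv
  rw [real_inner_smul_left, real_inner_smul_right] at h
  have : (c - d) * inner ℝ u v = 0 := by linarith
  exact (mul_eq_zero.1 this).resolve_left (sub_ne_zero.2 hcd)

theorem inner_snd_eq_zero {L : X →ₗ.[ℝ] X} (hsym : GraphSymmetric L) {c : ℝ} {p : X × X}
    (hp : p ∈ L.graph) {v : X} (hv : v ∈ eigenspace L c) (h : inner ℝ v p.1 = 0) :
    inner ℝ v p.2 = 0 := by
  have h' : inner ℝ (c • v) p.1 = inner ℝ v p.2 := hsym _ hv _ hp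
  rw [← h', real_inner_smul_left, h, mul_zero]

/-- If `c₀ + t⁻¹` lies in the resolvent set of `L`, then `(L - c₀)⁻¹ - t` is bounded below. -/
theorem boundedBelow_resolvent_sub {L : X →ₗ.[ℝ] X} {c₀ : ℝ} {T : X →L[ℝ] X}
    (hT : ∀ x, (T x, x + c₀ • T x) ∈ L.graph) {t : ℝ} (ht : t ≠ 0)
    (hc : c₀ + t⁻¹ ∈ resolventSet L) : ∃ k > 0, ∀ x, k * ‖x‖ ≤ ‖T x - t • x‖ := by
  obtain ⟨R, -, hR⟩ := mem_resolventSet_iff.1 hc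
  have hpos : 0 < |t|⁻¹ * (|t|⁻¹ * ‖R‖ + 1) := by
    have := abs_pos.2 ht
    positivity
  refine ⟨(|t|⁻¹ * (|t|⁻¹ * ‖R‖ + 1))⁻¹, inv_pos.2 hpos, fun x => ?_⟩
  rw [inv_mul_le_iff₀ hpos]
  set y := T x - t • x with hy
  have e1 : T x = -(t⁻¹ • R y) := by
    have h : R (x + c₀ • T x - (c₀ + t⁻¹) • T x) = T x := hR _ (hT x)
    rw [← h, ← map_smul R t⁻¹, ← map_neg R]
    congr 1
    rw [hy, smul_sub, inv_smul_smul₀ ht]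
    module
  have e2 : x = t⁻¹ • (-(t⁻¹ • R y) - y) := by
    rw [← e1, hy, sub_sub_cancel, inv_smul_smul₀ ht]
  calc ‖x‖ = ‖t⁻¹ • (-(t⁻¹ • R y) - y)‖ := by rw [← e2]
    _ ≤ |t|⁻¹ * (|t|⁻¹ * ‖R y‖ + ‖y‖) := by
        rw [norm_smul, norm_inv, Real.norm_eq_abs]
        gcongr
        refine (norm_sub_le _ _).trans ?_
        rw [norm_neg, norm_smul, norm_inv, Real.norm_eq_abs]
    _ ≤ |t|⁻¹ * (|t|⁻¹ * (‖R‖ * ‖y‖) + ‖y‖) := by gcongr; exact R.le_opNorm y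
    _ = _ := by ring

/-- A symmetric operator whose spectrum below `δ` is discrete satisfies `⟨L u, u⟩ ≥ b ‖u‖²` on
the orthogonal complement of its eigenvectors with eigenvalues below `b ≤ δ`. The bounded operator
`T = (L - c₀)⁻¹`, with `c₀` below the spectrum, is nonnegative and at most `(b - c₀)⁻¹` on this
complement, by the Rayleigh principle and since the eigenvalues of `L` below `b` are isolated. -/
theorem le_inner_of_orthogonal_eigenspaces [CompleteSpace X] {L : X →ₗ.[ℝ] X}
    (hsym : GraphSymmetric L) {δ : ℝ} (hL : DiscreteBelow L δ) {b : ℝ} (hb : b ≤ δ) {p : X × X}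
    (hp : p ∈ L.graph) (hu : ∀ c < b, ∀ v ∈ eigenspace L c, inner ℝ v p.1 = 0) :
    b * ‖p.1‖ ^ 2 ≤ inner ℝ p.2 p.1 := by
  obtain ⟨hfin, -⟩ := hL
  obtain ⟨c₀, hc₀b, hc₀⟩ : ∃ c₀ < b, ∀ c ∈ spec L ∩ Set.Iio δ, c₀ < c := by
    obtain ⟨l, hl⟩ := hfin.bddBelow
    refine ⟨min l b - 1, by linarith [min_le_right l b], fun c hc => ?_⟩
    linarith [hl hc, min_le_left l b]
  have hres : ∀ c < δ, c ∉ spec L ∩ Set.Iio δ → c ∈ resolventSet L := fun c hc h => by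
    by_contra h'
    exact h ⟨h', hc⟩
  obtain ⟨T, hT, hT'⟩ := mem_resolventSet_iff.1
    (hres c₀ (by linarith) fun h => lt_irrefl _ (hc₀ _ h))
  have hTs : ∀ x y, inner ℝ (T x) y = inner ℝ x (T y) := by
    intro x y
    have := hsym _ (hT x) _ (hT y)
    dsimp only at this
    rw [inner_add_left, inner_add_right, real_inner_smul_left, real_inner_smul_right] at this
    linarith
  have hTpos : ∀ x, 0 ≤ inner ℝ (T x) x := by
    intro x
    have := le_inner_of_boundedBelow hTs ⊤ (fun _ _ => trivial) 0 (fun m hm => ?_) x trivial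
    · simpa using this
    have hlt : c₀ + m⁻¹ < c₀ := by linarith [inv_lt_zero.2 hm]
    obtain ⟨k, hk, h⟩ := boundedBelow_resolvent_sub hT hm.ne
      (hres _ (by linarith) fun h => lt_asymm hlt (hc₀ _ h))
    exact ⟨k, hk, fun x _ => h x⟩
  set V : Submodule ℝ X :=
    { carrier := {x | ∀ c < b, ∀ v ∈ eigenspace L c, inner ℝ v x = 0}
      add_mem' := fun {x y} hx hy c hc v hv => by
        rw [inner_add_right, hx c hc v hv, hy c hc v hv, add_zero]
      zero_mem' := fun c _ v _ => inner_zero_right v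
      smul_mem' := fun a x hx c hc v hv => by
        rw [real_inner_smul_right, hx c hc v hv, mul_zero] } with hV
  have hTV : ∀ x ∈ V, T x ∈ V := by
    intro x hx c hc v hv
    have h1 : T (c • v - c₀ • v) = v := hT' _ hv
    rw [← sub_smul, map_smul] at h1
    rw [← hTs]
    rcases eq_or_ne (c - c₀) 0 with h0 | h0
    · rw [h0, zero_smul] at h1
      rw [← h1, map_zero, inner_zero_left]
    · have h2 := hx c hc v hv
      rw [← h1, real_inner_smul_left] at h2
      exact (mul_eq_zero.1 h2).resolve_left h0
  have hbc : 0 < b - c₀ := by linarith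
  have hupper : ∀ x ∈ V, inner ℝ (T x) x ≤ (b - c₀)⁻¹ * ‖x‖ ^ 2 := by
    intro x hx
    have := le_inner_of_boundedBelow (S := -T) (fun x y => by simp [hTs]) V
      (fun x hx => by simpa using V.neg_mem (hTV x hx)) (-(b - c₀)⁻¹) (fun m hm => ?_) x hx
    · simp only [neg_apply, inner_neg_left] at this
      linarith
    obtain ⟨t, rfl⟩ : ∃ t, m = -t := ⟨-m, by ring⟩
    have ht1 : (b - c₀)⁻¹ < t := by linarith
    have ht : 0 < t := (inv_pos.2 hbc).trans ht1
    have hcb : c₀ + t⁻¹ < b := by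
      have := (inv_lt_comm₀ hbc ht).1 ht1
      linarith
    suffices ∃ k > 0, ∀ x ∈ V, k * ‖x‖ ≤ ‖T x - t • x‖ by
      obtain ⟨k, hk, h⟩ := this
      refine ⟨k, hk, fun x hx => (h x hx).trans_eq ?_⟩
      rw [← norm_neg]; congr 1
      simp only [neg_apply]; module
    by_cases hspec : c₀ + t⁻¹ ∈ spec L ∩ Set.Iio δ
    · have hcont : ContinuousAt (fun t' : ℝ => c₀ + t'⁻¹) t :=
        continuousAt_const.add (continuousAt_inv₀ ht.ne')
      have hclosed : IsClosed ((spec L ∩ Set.Iio δ) \ {c₀ + t⁻¹}) :=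
        (hfin.subset Set.sdiff_subset).isClosed
      have hev : ∀ᶠ t' in 𝓝 t, 0 < t' ∧ c₀ + t'⁻¹ < δ ∧
          c₀ + t'⁻¹ ∈ ((spec L ∩ Set.Iio δ) \ {c₀ + t⁻¹})ᶜ :=
        (lt_mem_nhds ht).and ((hcont.eventually (gt_mem_nhds (by linarith))).and
          (hcont.eventually (hclosed.isOpen_compl.mem_nhds (by simp))))
      obtain ⟨r, hr, hball⟩ := Metric.eventually_nhds_iff.1 hev
      refine ⟨r, hr, fun x hx => ?_⟩
      have := norm_le_of_isolated (s := T - t • ContinuousLinearMap.id ℝ X) (fun x y => by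
        simp [inner_sub_left, inner_sub_right, hTs, real_inner_smul_left,
          real_inner_smul_right]) hr (fun t' ht' htr => ?_) (x := x) (fun v hv => ?_)
      · simpa using this
      · obtain ⟨h1, h2, h3⟩ := hball (y := t + t') (by simpa [Real.dist_eq] using htr)
        obtain ⟨k, hk, h⟩ := boundedBelow_resolvent_sub hT h1.ne' (hres _ h2 fun h => h3 ⟨h, by
          simpa using ht'⟩)
        refine ⟨k, hk, fun x => (h x).trans_eq ?_⟩
        congr 1
        simp only [sub_apply, smul_apply, ContinuousLinearMap.id_apply]
        module
      · apply hx _ hcb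
        rw [mem_eigenspace_iff]
        have hv' : T v = t • v := by simpa [sub_eq_zero] using hv
        have := L.graph.smul_mem t⁻¹ (hT v)
        rw [hv', Prod.smul_mk, inv_smul_smul₀ ht.ne', smul_add, smul_comm c₀ t,
          inv_smul_smul₀ ht.ne', ← add_smul, add_comm] at this
        exact this
    · obtain ⟨k, hk, h⟩ := boundedBelow_resolvent_sub hT ht.ne' (hres _ (by linarith) hspec)
      exact ⟨k, hk, fun x _ => h x⟩
  set x := p.2 - c₀ • p.1 with hx
  have hTx : T x = p.1 := hT' p hp
  have hxV : x ∈ V := by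
    intro c hc v hv
    rw [hx, inner_sub_right, real_inner_smul_right, hu c hc v hv,
      inner_snd_eq_zero hsym hp hv (hu c hc v hv)]
    simp
  -- Cauchy–Schwarz for the form of `T`
  have h1 := hTpos (x - (b - c₀) • p.1)
  have h2 := hupper p.1 hu
  have e : inner ℝ (T (x - (b - c₀) • p.1)) (x - (b - c₀) • p.1) = inner ℝ p.1 x
      - 2 * (b - c₀) * ‖p.1‖ ^ 2 + (b - c₀) ^ 2 * inner ℝ (T p.1) p.1 := by
    simp only [map_sub, map_smul, inner_sub_left, inner_sub_right, real_inner_smul_left,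
      real_inner_smul_right, hTx]
    rw [hTs p.1 x, hTx, real_inner_self_eq_norm_sq]
    ring
  have h3 : (b - c₀) ^ 2 * inner ℝ (T p.1) p.1 ≤ (b - c₀) * ‖p.1‖ ^ 2 := by
    calc (b - c₀) ^ 2 * inner ℝ (T p.1) p.1 ≤ (b - c₀) ^ 2 * ((b - c₀)⁻¹ * ‖p.1‖ ^ 2) := by gcongr
      _ = _ := by field_simp
  have e2 : inner ℝ p.1 x = inner ℝ p.2 p.1 - c₀ * ‖p.1‖ ^ 2 := by
    rw [hx, inner_sub_right, real_inner_smul_right, real_inner_self_eq_norm_sq,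
      real_inner_comm p.1 p.2]
  rw [e, e2] at h1
  linarith

/-- The number of eigenvalues of `L` in the set `S`, counted with geometric multiplicities. -/
def eigenvalueCount (L : X →ₗ.[ℝ] X) (S : Set ℝ) : ℕ :=
  ∑ᶠ c ∈ S, Module.finrank ℝ (eigenspace L c)

theorem finite_support_finrank {L : X →ₗ.[ℝ] X} {δ : ℝ} (hL : DiscreteBelow L δ) {S : Set ℝ}
    (hS : S ⊆ Set.Iio δ) :
    (S ∩ Function.support fun c => Module.finrank ℝ (eigenspace L c)).Finite := by
  refine hL.1.subset fun c hc => ⟨fun hc' => hc.2 ?_, hS hc.1⟩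
  dsimp only
  rw [eigenspace_eq_bot_of_mem_resolventSet hc', finrank_bot]

theorem finiteDimensional_eigenspace {L : X →ₗ.[ℝ] X} {δ : ℝ} (hL : DiscreteBelow L δ) {c : ℝ}
    (hc : c < δ) : FiniteDimensional ℝ (eigenspace L c) := by
  by_cases h : c ∈ spec L
  · exact (hL.2 c ⟨h, hc⟩).2
  · rw [eigenspace_eq_bot_of_mem_resolventSet (not_not.1 h)]
    infer_instance

theorem eigenvalueCount_union {L : X →ₗ.[ℝ] X} {δ : ℝ} (hL : DiscreteBelow L δ) {S S' : Set ℝ}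
    (hS : S ⊆ Set.Iio δ) (hS' : S' ⊆ Set.Iio δ) (h : Disjoint S S') :
    eigenvalueCount L (S ∪ S') = eigenvalueCount L S + eigenvalueCount L S' :=
  finsum_mem_union' h (finite_support_finrank hL hS) (finite_support_finrank hL hS')

theorem eigenvalueCount_pos {L : X →ₗ.[ℝ] X} {δ : ℝ} (hL : DiscreteBelow L δ) {S : Set ℝ}
    (hS : S ⊆ Set.Iio δ) {c : ℝ} (hc : c ∈ S) (hev : IsEigenvalue L c) :
    0 < eigenvalueCount L S := by
  have := finiteDimensional_eigenspace hL (hS hc)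
  have h1 : eigenvalueCount L S = eigenvalueCount L {c} + eigenvalueCount L (S \ {c}) := by
    rw [← eigenvalueCount_union hL (by simpa using hS hc) (Set.sdiff_subset.trans hS)
      Set.disjoint_sdiff_right, Set.union_sdiff_cancel (by simpa using hc)]
  have h2 : eigenvalueCount L {c} = Module.finrank ℝ (eigenspace L c) := finsum_mem_singleton
  have h3 : 0 < Module.finrank ℝ (eigenspace L c) :=
    Nat.pos_of_ne_zero fun h => hev (Submodule.finrank_eq_zero.1 h)
  omega

/-- A set `S` of reals below `δ` has an orthonormal system of eigenvectors that is complete for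
the eigenvalues in `S`. -/
theorem exists_orthonormal_eigenvectors {L : X →ₗ.[ℝ] X} (hsym : GraphSymmetric L) {δ : ℝ}
    (hL : DiscreteBelow L δ) {S : Set ℝ} (hS : S ⊆ Set.Iio δ) :
    ∃ (e : Fin (eigenvalueCount L S) → X) (μ : Fin (eigenvalueCount L S) → ℝ), Orthonormal ℝ e ∧
      (∀ i, μ i ∈ S ∧ e i ∈ eigenspace L (μ i)) ∧
      ∀ x, (∀ i, inner ℝ (e i) x = 0) → ∀ c ∈ S, ∀ v ∈ eigenspace L c, inner ℝ v x = 0 := by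
  classical
  set F := (finite_support_finrank hL hS).toFinset with hF
  have hFS : ∀ c ∈ F, c ∈ S := fun c hc => ((Set.Finite.mem_toFinset _).1 hc).1
  have hfd : ∀ c : F, FiniteDimensional ℝ (eigenspace L (c : ℝ)) := fun c =>
    finiteDimensional_eigenspace hL (hS (hFS c c.2))
  let bas : ∀ c : F, OrthonormalBasis (Fin (Module.finrank ℝ (eigenspace L (c : ℝ)))) ℝ
      (eigenspace L (c : ℝ)) := fun c => stdOrthonormalBasis ℝ _
  have hcard : Fintype.card (Σ c : F, Fin (Module.finrank ℝ (eigenspace L (c : ℝ)))) =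
      eigenvalueCount L S := by
    rw [Fintype.card_sigma]
    simp only [Fintype.card_fin]
    rw [Finset.sum_coe_sort F fun c => Module.finrank ℝ (eigenspace L c), eigenvalueCount,
      finsum_mem_eq_sum _ (finite_support_finrank hL hS)]
  let eq := (Fintype.equivFinOfCardEq hcard).symm
  have horth : OrthogonalFamily ℝ (fun c : F => eigenspace L (c : ℝ))
      fun c => (eigenspace L (c : ℝ)).subtypeₗᵢ := by
    intro c d hcd u v
    exact inner_eq_zero_of_mem_eigenspace hsym (fun h => hcd (Subtype.ext h)) u.2 v.2
  have hon := horth.orthonormal_sigma_orthonormal (v_family := fun c => bas c)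
    fun c => (bas c).orthonormal
  refine ⟨fun i => bas (eq i).1 (eq i).2, fun i => (eq i).1, hon.comp eq eq.injective,
    fun i => ⟨hFS _ (eq i).1.2, (bas (eq i).1 (eq i).2).2⟩, fun x hx c hc v hv => ?_⟩
  by_cases hcF : c ∈ F
  · have h1 := (bas ⟨c, hcF⟩).sum_repr ⟨v, hv⟩
    have h2 : v = ∑ i, (bas ⟨c, hcF⟩).repr ⟨v, hv⟩ i • (bas ⟨c, hcF⟩ i : X) := by
      have := congrArg Subtype.val h1
      simpa using this.symm
    rw [h2, sum_inner]
    refine Finset.sum_eq_zero fun i _ => ?_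
    have := hx (eq.symm ⟨⟨c, hcF⟩, i⟩)
    dsimp only at this
    rw [Equiv.apply_symm_apply] at this
    rw [real_inner_smul_left, this, mul_zero]
  · have := finiteDimensional_eigenspace hL (hS hc)
    have : Module.finrank ℝ (eigenspace L c) = 0 := by
      by_contra h
      exact hcF ((Set.Finite.mem_toFinset _).2 ⟨hc, h⟩)
    rw [Submodule.finrank_eq_zero.1 this, Submodule.mem_bot] at hv
    rw [hv, inner_zero_left]

/-- A symmetric operator with discrete spectrum below `δ` is bounded below by `δ` up to a quadratic
form of finite rank. -/
theorem exists_le_inner_add_sum [CompleteSpace X] {L : X →ₗ.[ℝ] X} (hsym : GraphSymmetric L)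
    {δ : ℝ} (hL : DiscreteBelow L δ) : ∃ (m : ℕ) (e : Fin m → X) (κ : Fin m → ℝ), ∀ p ∈ L.graph,
      δ * ‖p.1‖ ^ 2 ≤ inner ℝ p.2 p.1 + ∑ i, κ i * inner ℝ p.1 (e i) ^ 2 := by
  obtain ⟨e, μ, hon, hev, hcompl⟩ := exists_orthonormal_eigenvectors hsym hL le_rfl
  refine ⟨_, e, fun i => δ - μ i, fun p hp => ?_⟩
  set a := fun i => inner ℝ p.1 (e i) with ha
  set q : X × X := p - ∑ i, a i • (e i, μ i • e i) with hq
  have hqg : q ∈ L.graph := L.graph.sub_mem hp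
    (L.graph.sum_mem fun i _ => L.graph.smul_mem _ (hev i).2)
  have hq1 : q.1 = p.1 - ∑ i, a i • e i := by simp [hq, Prod.fst_sum]
  have hq2 : q.2 = p.2 - ∑ i, a i • μ i • e i := by simp [hq, Prod.snd_sum]
  have horth : ∀ i, inner ℝ (e i) q.1 = 0 := by
    intro i
    rw [hq1, inner_sub_right, hon.inner_right_fintype, real_inner_comm, ha, sub_self]
  have hb := le_inner_of_orthogonal_eigenspaces hsym hL le_rfl hqg fun c hc v hv =>
    hcompl _ horth c hc v hv
  have e1 : ‖q.1‖ ^ 2 = ‖p.1‖ ^ 2 - ∑ i, a i ^ 2 := by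
    rw [← real_inner_self_eq_norm_sq, ← real_inner_self_eq_norm_sq]
    nth_rewrite 1 [hq1]
    rw [inner_sub_left, sum_inner, Finset.sum_eq_zero fun i _ => by
      rw [real_inner_smul_left, horth, mul_zero], sub_zero, hq1, inner_sub_right, inner_sum]
    congr 1
    refine Finset.sum_congr rfl fun i _ => ?_
    rw [real_inner_smul_right]; ring
  have e2 : inner ℝ q.2 q.1 = inner ℝ p.2 p.1 - ∑ i, μ i * a i ^ 2 := by
    nth_rewrite 1 [hq2]
    rw [inner_sub_left, sum_inner, Finset.sum_eq_zero fun i _ => by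
      rw [real_inner_smul_left, real_inner_smul_left, horth, mul_zero, mul_zero], sub_zero, hq1,
      inner_sub_right, inner_sum]
    congr 1
    refine Finset.sum_congr rfl fun i _ => ?_
    have h := hsym _ hp _ (hev i).2
    have h' : inner ℝ p.2 (e i) = inner ℝ p.1 (μ i • e i) := h
    rw [real_inner_smul_right, h', real_inner_smul_right]
    ring
  rw [e1, e2] at hb
  have e3 : ∑ i, (δ - μ i) * inner ℝ p.1 (e i) ^ 2 = δ * ∑ i, a i ^ 2 - ∑ i, μ i * a i ^ 2 := by
    rw [Finset.mul_sum, ← Finset.sum_sub_distrib]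
    exact Finset.sum_congr rfl fun i _ => by ring
  rw [e3]
  linarith

end

/-! ### Weak convergence along ultrafilters -/

section

variable {X : Type*} [NormedAddCommGroup X] [InnerProductSpace ℝ X]

/-- Weak convergence of `u` to `x` along the filter `l`. -/
def WeakTendsto {ι : Type*} (l : Filter ι) (u : ι → X) (x : X) : Prop :=
  ∀ v : X, Tendsto (fun n => inner ℝ (u n) v) l (𝓝 (inner ℝ x v))

namespace WeakTendsto

variable {ι : Type*} {l : Filter ι} {u w : ι → X} {x y : X}

theorem of_tendsto (h : Tendsto u l (𝓝 x)) : WeakTendsto l u x := fun _ =>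
  h.inner tendsto_const_nhds

theorem add (hu : WeakTendsto l u x) (hw : WeakTendsto l w y) :
    WeakTendsto l (fun n => u n + w n) (x + y) := fun v => by
  simpa only [inner_add_left] using (hu v).add (hw v)

theorem sub (hu : WeakTendsto l u x) (hw : WeakTendsto l w y) :
    WeakTendsto l (fun n => u n - w n) (x - y) := fun v => by
  simpa only [inner_sub_left] using (hu v).sub (hw v)

theorem smul {a : ι → ℝ} {b : ℝ} (ha : Tendsto a l (𝓝 b)) (hu : WeakTendsto l u x) :
    WeakTendsto l (fun n => a n • u n) (b • x) := fun v => by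
  simpa only [real_inner_smul_left] using ha.mul (hu v)

theorem sum {κ : Type*} (s : Finset κ) {u : κ → ι → X} {x : κ → X}
    (h : ∀ k ∈ s, WeakTendsto l (u k) (x k)) :
    WeakTendsto l (fun n => ∑ k ∈ s, u k n) (∑ k ∈ s, x k) := fun v => by
  simpa only [sum_inner] using tendsto_finsetSum s fun k hk => h k hk v

theorem congr' (hu : WeakTendsto l u x) (h : ∀ᶠ n in l, u n = w n) : WeakTendsto l w x :=
  fun v => (hu v).congr' (h.mono fun n hn => by rw [hn])

theorem unique [l.NeBot] (hu : WeakTendsto l u x) (hu' : WeakTendsto l u y) : x = y := by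
  refine ext_inner_right ℝ fun v => tendsto_nhds_unique (hu v) (hu' v)

theorem clm [CompleteSpace X] (K : X →L[ℝ] X) (hu : WeakTendsto l u x) :
    WeakTendsto l (fun n => K (u n)) (K x) := fun v => by
  simpa only [ContinuousLinearMap.adjoint_inner_right] using hu (ContinuousLinearMap.adjoint K v)

end WeakTendsto

/-- Bounded families converge weakly along ultrafilters (Banach–Alaoglu). -/
theorem exists_weakTendsto [CompleteSpace X] {ι : Type*} (U : Ultrafilter ι) {u : ι → X} {C : ℝ}
    (h : ∀ᶠ n in U, ‖u n‖ ≤ C) : ∃ x, WeakTendsto (U : Filter ι) u x := by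
  have hK := WeakDual.isCompact_closedBall (𝕜 := ℝ) (0 : StrongDual ℝ X) C
  obtain ⟨f, -, hf⟩ := hK.ultrafilter_le_nhds
    (U.map fun n => StrongDual.toWeakDual (InnerProductSpace.toDual ℝ X (u n))) (by
      rw [le_principal_iff, Ultrafilter.mem_coe, Ultrafilter.mem_map]
      filter_upwards [h] with n hn
      simpa using hn)
  refine ⟨(InnerProductSpace.toDual ℝ X).symm (WeakDual.toStrongDual f), fun v => ?_⟩
  have h1 : Tendsto (fun n => StrongDual.toWeakDual (InnerProductSpace.toDual ℝ X (u n))) U (𝓝 f) :=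
    hf
  have h2 := ((WeakDual.eval_continuous v).tendsto f).comp h1
  rw [InnerProductSpace.toDual_symm_apply]
  exact h2

/-- Compact operators map bounded weakly convergent families to norm-convergent ones. -/
theorem WeakTendsto.tendsto_of_isCompactOperator [CompleteSpace X] {ι : Type*} {U : Ultrafilter ι}
    {u : ι → X} {x : X} (hu : WeakTendsto (U : Filter ι) u x) {C : ℝ} (h : ∀ᶠ n in U, ‖u n‖ ≤ C)
    {K : X →L[ℝ] X} (hK : IsCompactOperator K) :
    Tendsto (fun n => K (u n)) (U : Filter ι) (𝓝 (K x)) := by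
  obtain ⟨S, hS, hsub⟩ := hK.image_closedBall_subset_compact (f := K.toLinearMap) C
  obtain ⟨y, -, hy⟩ := hS.ultrafilter_le_nhds (U.map fun n => K (u n)) (by
      rw [le_principal_iff, Ultrafilter.mem_coe, Ultrafilter.mem_map]
      filter_upwards [h] with n hn
      exact hsub ⟨u n, by simpa using hn, rfl⟩)
  have h1 : Tendsto (fun n => K (u n)) (U : Filter ι) (𝓝 y) := hy
  rwa [(hu.clm K).unique (WeakTendsto.of_tendsto h1)]

/-- Ehrling's inequality: a compact operator is bounded relative to an injective bounded
operator with arbitrarily small leading constant. -/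
theorem exists_norm_le_of_isCompactOperator [CompleteSpace X] {K : X →L[ℝ] X}
    (hK : IsCompactOperator K) {G : X →L[ℝ] X} (hG : ∀ g, G g = 0 → g = 0) {η : ℝ} (hη : 0 < η) :
    ∃ C ≥ 0, ∀ g, ‖K g‖ ≤ η * ‖g‖ + C * ‖G g‖ := by
  by_contra! hcon
  choose g hg using fun n : ℕ => hcon n n.cast_nonneg
  have hg0 : ∀ n, 0 < ‖g n‖ := by
    intro n
    rw [norm_pos_iff]
    intro h
    simpa [h] using hg n
  set v : ℕ → X := fun n => ‖g n‖⁻¹ • g n with hv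
  have hv1 : ∀ n, ‖v n‖ = 1 := fun n => by
    rw [hv]; simp only
    rw [norm_smul, norm_inv, norm_norm, inv_mul_cancel₀ (hg0 n).ne']
  have hvb : ∀ n, η + n * ‖G (v n)‖ < ‖K (v n)‖ := by
    intro n
    simp only [hv, map_smul, norm_smul, norm_inv, norm_norm]
    have := mul_lt_mul_of_pos_left (hg n) (inv_pos.2 (hg0 n))
    have e : ‖g n‖⁻¹ * (η * ‖g n‖ + n * ‖G (g n)‖) = η + n * (‖g n‖⁻¹ * ‖G (g n)‖) := by
      have := (hg0 n).ne'
      field_simp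
    linarith
  let U : Ultrafilter ℕ := Ultrafilter.of atTop
  have hU : (U : Filter ℕ) ≤ atTop := Ultrafilter.of_le _
  have hb : ∀ᶠ n in U, ‖v n‖ ≤ 1 := Eventually.of_forall fun n => (hv1 n).le
  obtain ⟨x, hx⟩ := exists_weakTendsto U hb
  have hGv : Tendsto (fun n => G (v n)) U (𝓝 0) := by
    have h1 : Tendsto (fun n : ℕ => ‖K‖ / n) U (𝓝 0) :=
      (tendsto_const_div_atTop_nhds_zero_nat _).mono_left hU
    refine squeeze_zero_norm' ?_ h1
    filter_upwards [hU (eventually_gt_atTop 0)] with n hn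
    have hn' : (0 : ℝ) < n := by exact_mod_cast hn
    rw [le_div_iff₀ hn']
    have h2 := K.le_opNorm (v n)
    rw [hv1 n, mul_one] at h2
    linarith [hvb n]
  have hx0 : x = 0 := hG x ((hx.clm G).unique (WeakTendsto.of_tendsto hGv))
  have hKv := hx.tendsto_of_isCompactOperator hb hK
  rw [hx0, map_zero] at hKv
  have h3 : ∀ᶠ n in U, ‖K (v n)‖ < η := by
    have := hKv.norm
    rw [norm_zero] at this
    exact this.eventually (gt_mem_nhds hη)
  obtain ⟨n, hn⟩ := h3.exists
  have := hvb n
  have : (0 : ℝ) ≤ n * ‖G (v n)‖ := by positivity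
  linarith

/-- A frequently occurring property of natural numbers holds eventually along some
ultrafilter finer than `atTop`. -/
theorem exists_ultrafilter_of_frequently {p : ℕ → Prop} (h : ∃ᶠ n in atTop, p n) :
    ∃ U : Ultrafilter ℕ, (U : Filter ℕ) ≤ atTop ∧ ∀ᶠ n in U, p n := by
  have : NeBot (atTop ⊓ 𝓟 {n | p n}) := frequently_mem_iff_neBot.1 h
  have hle := Ultrafilter.of_le (atTop ⊓ 𝓟 {n | p n})
  exact ⟨Ultrafilter.of (atTop ⊓ 𝓟 {n | p n}), hle.trans inf_le_left,
    le_principal_iff.1 (hle.trans inf_le_right)⟩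

/-- A bounded real family converges along every ultrafilter. -/
theorem exists_tendsto_of_mem_Icc {ι : Type*} (U : Ultrafilter ι) {a : ι → ℝ} {c d : ℝ}
    (h : ∀ᶠ n in U, a n ∈ Set.Icc c d) : ∃ b, Tendsto a U (𝓝 b) := by
  obtain ⟨b, -, hb⟩ := isCompact_Icc.ultrafilter_le_nhds (U.map a) (s := Set.Icc c d) (by
      rw [le_principal_iff, Ultrafilter.mem_coe, Ultrafilter.mem_map]
      exact h)
  exact ⟨b, hb⟩

end

/-! ### Description of the family by bounded operators -/

section

variable {X : Type*} [NormedAddCommGroup X] [InnerProductSpace ℝ X]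

theorem isBoundedQuotient_self (A : X →ₗ.[ℝ] X) :
    IsBoundedQuotient A A (ContinuousLinearMap.id ℝ X) := fun u => ⟨u.2, rfl⟩

theorem IsBoundedQuotient.add {T T' A : X →ₗ.[ℝ] X} {K K' : X →L[ℝ] X}
    (h : IsBoundedQuotient T A K) (h' : IsBoundedQuotient T' A K') :
    IsBoundedQuotient (T + T') A (K + K') := fun u => by
  obtain ⟨h1, h2⟩ := h u
  obtain ⟨h3, h4⟩ := h' u
  refine ⟨⟨h1, h3⟩, ?_⟩
  rw [add_apply, ← h2, ← h4]
  rfl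

theorem IsBoundedQuotient.sum {ι : Type*} (s : Finset ι) {T : ι → X →ₗ.[ℝ] X} {A : X →ₗ.[ℝ] X}
    {K : ι → X →L[ℝ] X} (h : ∀ j, IsBoundedQuotient (T j) A (K j)) :
    IsBoundedQuotient (∑ j ∈ s, T j) A (∑ j ∈ s, K j) := by
  classical
  induction s using Finset.induction_on with
  | empty => exact fun u => ⟨by rw [Finset.sum_empty]; trivial, by simp⟩
  | insert j s hj ih =>
    rw [Finset.sum_insert hj, Finset.sum_insert hj]
    exact (h j).add ih

theorem mem_graph_conj_iff {τ : X ≃ₗᵢ[ℝ] X} {T : X →ₗ.[ℝ] X} {p : X × X} :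
    p ∈ (conj τ T).graph ↔ (τ p.1, τ p.2) ∈ T.graph := by
  rw [LinearPMap.mem_graph_iff, LinearPMap.mem_graph_iff]
  constructor
  · rintro ⟨u, hu, hu'⟩
    refine ⟨⟨τ u, u.2⟩, by rw [← hu], ?_⟩
    rw [← hu']
    exact (τ.apply_symm_apply _).symm
  · rintro ⟨u, hu, hu'⟩
    dsimp only at hu hu'
    have hm : τ p.1 ∈ T.domain := hu ▸ u.2
    refine ⟨⟨p.1, hm⟩, rfl, ?_⟩
    have e : (⟨τ p.1, hm⟩ : T.domain) = u := Subtype.ext hu.symm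
    have h1 : conj τ T ⟨p.1, hm⟩ = τ.symm (T ⟨τ p.1, hm⟩) := rfl
    rw [h1, e, hu', τ.symm_apply_apply]

theorem IsBoundedQuotient.mem_graph {T A : X →ₗ.[ℝ] X} {K : X →L[ℝ] X}
    (h : IsBoundedQuotient T A K) {p : X × X} (hp : p ∈ A.graph) : (p.1, K p.2) ∈ T.graph := by
  obtain ⟨u, hu, hu'⟩ := (LinearPMap.mem_graph_iff A).1 hp
  obtain ⟨h1, h2⟩ := h u
  rw [LinearPMap.mem_graph_iff]
  exact ⟨⟨u, h1⟩, hu, by rw [h2, hu']⟩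

theorem isBoundedQuotient_of_mem_graph {T A : X →ₗ.[ℝ] X} {K : X →L[ℝ] X}
    (h : ∀ p ∈ A.graph, (p.1, K p.2) ∈ T.graph) : IsBoundedQuotient T A K := fun u => by
  obtain ⟨v, hv, hv'⟩ := (LinearPMap.mem_graph_iff T).1 (h _ (A.mem_graph u))
  dsimp only at hv hv'
  have hm : (u : X) ∈ T.domain := hv ▸ v.2
  have e : (⟨u, hm⟩ : T.domain) = v := Subtype.ext hv.symm
  exact ⟨hm, by rw [e, hv']⟩

/-- The operator `τ⁻¹ K τ` for a bounded operator `K`. -/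
def conjBounded (τ : X ≃ₗᵢ[ℝ] X) (K : X →L[ℝ] X) : X →L[ℝ] X :=
  (τ.symm : X →L[ℝ] X) ∘L K ∘L (τ : X →L[ℝ] X)

@[simp] theorem conjBounded_apply (τ : X ≃ₗᵢ[ℝ] X) (K : X →L[ℝ] X) (x : X) :
    conjBounded τ K x = τ.symm (K (τ x)) := rfl

theorem IsBoundedQuotient.conj {T A : X →ₗ.[ℝ] X} {K : X →L[ℝ] X} {τ : X ≃ₗᵢ[ℝ] X}
    (h : IsBoundedQuotient T A K) (hτ : IsoInertia.conj τ A = A) :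
    IsBoundedQuotient (IsoInertia.conj τ T) A (conjBounded τ K) :=
  isBoundedQuotient_of_mem_graph fun p hp => by
    rw [← hτ, mem_graph_conj_iff] at hp
    rw [mem_graph_conj_iff]
    simpa using h.mem_graph hp

/-- The bounded operators that describe the family `L_n`: the inverse `G` of `A`, and the
quotients `K j = B^j A⁻¹` and `P n = R_n A⁻¹`. The graphs of `A`, `A + B^j` and `L_n` are
parametrized by `g = A u`, so that domains no longer appear. -/
structure BoundedModel {N : ℕ} (A : X →ₗ.[ℝ] X) (B : Fin N → X →ₗ.[ℝ] X)
    (R : ℕ → X →ₗ.[ℝ] X) (τ : Fin N → ℕ → X ≃ₗᵢ[ℝ] X) where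
  /-- `A⁻¹` -/
  G : X →L[ℝ] X
  /-- `B^j A⁻¹` -/
  K : Fin N → X →L[ℝ] X
  /-- `R_n A⁻¹` -/
  P : ℕ → X →L[ℝ] X
  /-- `A (G g) = g`. -/
  mem_graph_A : ∀ g, (G g, g) ∈ A.graph
  injective_G : ∀ g, G g = 0 → g = 0
  mem_graph_B : ∀ j p, p ∈ (A + B j).graph ↔ ∃ g, p = (G g, g + K j g)
  mem_graph_L : ∀ n p, p ∈ (Ln A B R τ n).graph ↔
    ∃ g, p = (G g, g + ∑ j, (τ j n).symm (K j (τ j n g)) + P n g)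
  commutes : ∀ j n g, τ j n (G g) = G (τ j n g)
  compact : ∀ j, IsCompactOperator (K j)
  tendsto_P : Tendsto (fun n => ‖P n‖) atTop (𝓝 0)
  weak : ∀ x j l, j ≠ l → WeakTendsto atTop (fun n => τ j n ((τ l n).symm x)) 0

/-- If `L = S A` and the domains of `L` and `A` coincide, the graph of `L` is parametrized by
`g = A u`. -/
theorem mem_graph_iff_of_isBoundedQuotient {A L : X →ₗ.[ℝ] X} {S G : X →L[ℝ] X}
    (hL : IsBoundedQuotient L A S) (hdom : L.domain = A.domain) (hG : ∀ g, (G g, g) ∈ A.graph)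
    (hG' : ∀ p ∈ A.graph, G p.2 = p.1) (p : X × X) : p ∈ L.graph ↔ ∃ g, p = (G g, S g) := by
  constructor
  · intro hp
    obtain ⟨u, hu, hu'⟩ := (LinearPMap.mem_graph_iff L).1 hp
    have hm : (u : X) ∈ A.domain := hdom ▸ u.2
    have hA := A.mem_graph ⟨u, hm⟩
    refine ⟨A ⟨u, hm⟩, ?_⟩
    have h1 := L.mem_graph_snd_inj (hL.mem_graph hA) (L.mem_graph u) rfl
    refine Prod.ext ?_ ?_
    · rw [← hu]; exact (hG' _ hA).symm
    · rw [← hu']; exact h1.symm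
  · rintro ⟨g, rfl⟩
    exact hL.mem_graph (hG g)

theorem exists_boundedModel [CompleteSpace X] {N : ℕ} {A : X →ₗ.[ℝ] X} {B : Fin N → X →ₗ.[ℝ] X}
    {R : ℕ → X →ₗ.[ℝ] X} {τ : Fin N → ℕ → X ≃ₗᵢ[ℝ] X} (hA : Assumptions A B R τ) :
    Nonempty (BoundedModel A B R τ) := by
  obtain ⟨G, hG, hG'⟩ := mem_resolventSet_iff.1 hA.invertible
  simp only [zero_smul, add_zero, sub_zero] at hG hG'
  choose K hK hKc using hA.compact
  obtain ⟨P, hP, hP0⟩ := hA.remainder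
  refine ⟨⟨G, K, P, hG, fun g hg => ?_, fun j p => ?_, fun n p => ?_, fun j n g => ?_, hKc, hP0,
    fun x j l hjl v => ?_⟩⟩
  · exact A.graph_fst_eq_zero_snd (hG g) hg
  · rw [mem_graph_iff_of_isBoundedQuotient ((isBoundedQuotient_self A).add (hK j))
      (hA.selfAdjoint_B j).2 hG hG']
    rfl
  · have h := ((isBoundedQuotient_self A).add (IsBoundedQuotient.sum Finset.univ
      fun j => (hK j).conj (hA.commutes j n))).add (hP n)
    rw [mem_graph_iff_of_isBoundedQuotient (L := Ln A B R τ n) h (hA.selfAdjoint_L n).2 hG hG']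
    simp
  · have h := hG g
    rw [← hA.commutes j n, mem_graph_conj_iff] at h
    exact (hG' _ h).symm
  · simpa [ratio] using hA.weak x j l hjl v

end

/-! ### Profile decomposition of eigenvectors -/

section

variable {X : Type*} [NormedAddCommGroup X] [InnerProductSpace ℝ X] {N : ℕ}
  {A : X →ₗ.[ℝ] X} {B : Fin N → X →ₗ.[ℝ] X} {R : ℕ → X →ₗ.[ℝ] X} {τ : Fin N → ℕ → X ≃ₗᵢ[ℝ] X}

/-- Isometries do not affect convergence to zero. -/
theorem tendsto_isometry_zero {ι : Type*} {l : Filter ι} (T : ι → X ≃ₗᵢ[ℝ] X) {u : ι → X}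
    (h : Tendsto u l (𝓝 0)) : Tendsto (fun n => T n (u n)) l (𝓝 0) := by
  rw [tendsto_zero_iff_norm_tendsto_zero] at h ⊢
  simpa using h

theorem BoundedModel.tendsto_remainder (M : BoundedModel A B R τ) {l : Filter ℕ} (hl : l ≤ atTop)
    {g : ℕ → X} {C : ℝ} (h : ∀ᶠ n in l, ‖g n‖ ≤ C) :
    Tendsto (fun n => M.P n (g n)) l (𝓝 0) := by
  have h1 : Tendsto (fun n => ‖M.P n‖ * C) l (𝓝 0) := by
    simpa using (M.tendsto_P.mono_left hl).mul_const C
  refine squeeze_zero_norm' ?_ h1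
  filter_upwards [h] with n hn
  exact (M.P n).le_opNorm _ |>.trans (by gcongr)

/-- Translates by different sequences of isometries are asymptotically orthogonal. -/
theorem BoundedModel.tendsto_inner_translates (M : BoundedModel A B R τ) (j l : Fin N) (x y : X) :
    Tendsto (fun n => inner ℝ ((τ j n).symm x) ((τ l n).symm y)) atTop
      (𝓝 (if j = l then inner ℝ x y else 0)) := by
  split_ifs with h
  · subst h
    simp
  · have h1 := M.weak x l j (Ne.symm h) y
    rw [inner_zero_left] at h1
    refine h1.congr fun n => ?_
    rw [← LinearIsometryEquiv.inner_map_map (τ l n) ((τ j n).symm x),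
      LinearIsometryEquiv.apply_symm_apply]

variable [CompleteSpace X]

/-- The perturbation `∑ j, B_n^j + R_n` is bounded relative to `A`, uniformly for large `n`, with
relative bound at most `1 / 2`. -/
theorem BoundedModel.exists_perturbation_bound (M : BoundedModel A B R τ) :
    ∃ C ≥ 0, ∀ᶠ n in atTop, ∀ g,
      ‖∑ j, (τ j n).symm (M.K j (τ j n g)) + M.P n g‖ ≤ 1 / 2 * ‖g‖ + C * ‖M.G g‖ := by
  have hη : 0 < 1 / (4 * ((N : ℝ) + 1)) := by positivity
  choose C hC0 hC using fun j => exists_norm_le_of_isCompactOperator (M.compact j) M.injective_G hη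
  refine ⟨∑ j, C j, Finset.sum_nonneg fun j _ => hC0 j, ?_⟩
  filter_upwards [M.tendsto_P.eventually (gt_mem_nhds (show (0 : ℝ) < 1 / 4 by norm_num))]
    with n hn g
  have h1 : ‖∑ j, (τ j n).symm (M.K j (τ j n g))‖ ≤ 1 / 4 * ‖g‖ + (∑ j, C j) * ‖M.G g‖ := by
    calc ‖∑ j, (τ j n).symm (M.K j (τ j n g))‖
        ≤ ∑ j, (1 / (4 * ((N : ℝ) + 1)) * ‖g‖ + C j * ‖M.G g‖) := by
          refine norm_sum_le_of_le _ fun j _ => ?_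
          rw [LinearIsometryEquiv.norm_map]
          refine (hC j _).trans_eq ?_
          rw [← M.commutes, LinearIsometryEquiv.norm_map, LinearIsometryEquiv.norm_map]
      _ = N / (N + 1) * (1 / 4 * ‖g‖) + (∑ j, C j) * ‖M.G g‖ := by
          rw [Finset.sum_add_distrib, ← Finset.sum_mul, Finset.sum_const, Finset.card_univ,
            Fintype.card_fin, nsmul_eq_mul, ← Finset.sum_mul]
          field_simp
      _ ≤ 1 * (1 / 4 * ‖g‖) + (∑ j, C j) * ‖M.G g‖ := by
          gcongr
          rw [div_le_one (by positivity)]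
          linarith
      _ = _ := by ring
  have h2 : ‖M.P n g‖ ≤ 1 / 4 * ‖g‖ := (M.P n).le_opNorm g |>.trans (by gcongr)
  calc _ ≤ _ := norm_add_le _ _
    _ ≤ _ := by linarith

/-- Eigenvalues of `L_n` in `(-∞, b]` are bounded below uniformly for large `n`, and their
normalized eigenvectors are bounded in the graph norm of `A`. -/
theorem BoundedModel.exists_eigenvector_bound (M : BoundedModel A B R τ)
    (hA : Assumptions A B R τ) (b : ℝ) :
    ∃ C, ∀ᶠ n in atTop, ∀ g μ, ‖M.G g‖ = 1 → μ ≤ b →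
      g + ∑ j, (τ j n).symm (M.K j (τ j n g)) + M.P n g = μ • M.G g → |μ| ≤ C ∧ ‖g‖ ≤ C := by
  obtain ⟨δ, -, hδA, -⟩ := hA.discrete
  have hsym := graphSymmetric_of_isSelfAdjoint hA.selfAdjoint_A
  obtain ⟨C₀, hC₀, hpert⟩ := M.exists_perturbation_bound
  -- `A ≥ -a`
  obtain ⟨a, ha, hform⟩ : ∃ a ≥ 0, ∀ g, -a * ‖M.G g‖ ^ 2 ≤ inner ℝ g (M.G g) := by
    obtain ⟨l, hl⟩ := hδA.1.bddBelow
    refine ⟨-min (min l δ) 0, by simp, fun g => ?_⟩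
    rw [neg_neg]
    refine le_inner_of_orthogonal_eigenspaces hsym hδA
      ((min_le_left _ _).trans (min_le_right _ _)) (M.mem_graph_A g) fun c hc v hv => ?_
    have h1 : c < min l δ := hc.trans_le (min_le_left _ _)
    have h2 : c ∈ resolventSet A := by
      by_contra h
      exact absurd (hl ⟨h, h1.trans_le (min_le_right _ _)⟩)
        (not_le.2 (h1.trans_le (min_le_left _ _)))
    rw [eigenspace_eq_bot_of_mem_resolventSet h2, Submodule.mem_bot] at hv
    rw [hv, inner_zero_left]
  set m := 4 * a + 2 * C₀ + |b| with hm
  have hb0 := abs_nonneg b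
  refine ⟨2 * (m + C₀), ?_⟩
  filter_upwards [hpert] with n hn g μ hg hμ heq
  set E := ∑ j, (τ j n).symm (M.K j (τ j n g)) + M.P n g with hE
  have h1 := hn g
  rw [hg, mul_one, ← hE] at h1
  have h2 : g - μ • M.G g = -E := by
    rw [← heq, hE]; abel
  have hmu : |μ| ≤ m := by
    by_contra! hlt
    have hneg : μ < 0 := by
      by_contra! h0
      rw [abs_of_nonneg h0] at hlt
      linarith [le_abs_self b]
    rw [abs_of_neg hneg] at hlt
    have h3 : ‖E‖ ^ 2 = ‖g‖ ^ 2 - 2 * μ * inner ℝ g (M.G g) + μ ^ 2 := by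
      rw [← norm_neg, ← h2, norm_sub_sq_real, real_inner_smul_right, norm_smul, hg, mul_one,
        Real.norm_eq_abs, sq_abs]
      ring
    have h4 := hform g
    rw [hg] at h4
    have h5 : -2 * μ * (-a) ≤ -2 * μ * inner ℝ g (M.G g) :=
      mul_le_mul_of_nonneg_left (by linarith) (by linarith)
    have h6 : ‖E‖ ^ 2 ≤ (1 / 2 * ‖g‖ + C₀) ^ 2 := pow_le_pow_left₀ (norm_nonneg _) h1 2
    have h7 : 0 ≤ (1 / 2 * ‖g‖ - C₀) ^ 2 := sq_nonneg _
    have h8 : 4 * a * -μ ≤ μ ^ 2 := by nlinarith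
    have h9 : (2 * C₀) ^ 2 < μ ^ 2 := by nlinarith
    nlinarith [sq_nonneg ‖g‖]
  refine ⟨by linarith [abs_nonneg μ], ?_⟩
  have h3 : g = μ • M.G g - E := by rw [sub_eq_add_neg, ← h2]; abel
  have h4 : ‖g‖ ≤ |μ| + ‖E‖ := by
    calc ‖g‖ = ‖μ • M.G g - E‖ := by rw [← h3]
      _ ≤ ‖μ • M.G g‖ + ‖E‖ := norm_sub_le _ _
      _ = |μ| + ‖E‖ := by rw [norm_smul, hg, mul_one, Real.norm_eq_abs]
  linarith

/-- A family in `D(A)` that converges weakly to zero and satisfies `(A - ν) w_n → 0` for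
some `ν < δ` converges strongly to zero, because `A - δ` is nonnegative up to finite rank. -/
theorem BoundedModel.tendsto_zero_of_weak (M : BoundedModel A B R τ) (hsym : GraphSymmetric A)
    {δ : ℝ} (hδ : DiscreteBelow A δ) {ν : ℝ} (hν : ν < δ) {ι : Type*} {l : Filter ι} {h : ι → X}
    {C : ℝ} (hb : ∀ᶠ n in l, ‖h n‖ ≤ C) (hw : WeakTendsto l (fun n => M.G (h n)) 0)
    (hd : Tendsto (fun n => h n - ν • M.G (h n)) l (𝓝 0)) :
    Tendsto (fun n => M.G (h n)) l (𝓝 0) := by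
  obtain ⟨m, e, κ, hform⟩ := exists_le_inner_add_sum hsym hδ
  have h1 : Tendsto (fun n => ∑ i, κ i * inner ℝ (M.G (h n)) (e i) ^ 2) l (𝓝 0) := by
    have : Tendsto (fun n => ∑ i, κ i * inner ℝ (M.G (h n)) (e i) ^ 2) l
        (𝓝 (∑ i, κ i * inner ℝ (0 : X) (e i) ^ 2)) :=
      tendsto_finsetSum _ fun i _ => ((hw (e i)).pow 2).const_mul _
    simpa using this
  have h2 : Tendsto (fun n => inner ℝ (h n - ν • M.G (h n)) (M.G (h n))) l (𝓝 0) := by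
    have h3 : Tendsto (fun n => ‖h n - ν • M.G (h n)‖ * (‖M.G‖ * C)) l (𝓝 0) := by
      simpa using hd.norm.mul_const (‖M.G‖ * C)
    refine squeeze_zero_norm' ?_ h3
    filter_upwards [hb] with n hn
    refine (norm_inner_le_norm _ _).trans ?_
    gcongr
    exact (M.G.le_opNorm _).trans (by gcongr)
  have h4 := ((h2.add h1).const_mul (δ - ν)⁻¹)
  rw [add_zero, mul_zero] at h4
  have h5 : Tendsto (fun n => ‖M.G (h n)‖ ^ 2) l (𝓝 0) := by
    refine squeeze_zero (fun n => sq_nonneg _) (fun n => ?_) h4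
    rw [← div_eq_inv_mul, le_div_iff₀ (by linarith)]
    have := hform _ (M.mem_graph_A (h n))
    dsimp only at this
    rw [inner_sub_left, real_inner_smul_left, real_inner_self_eq_norm_sq]
    linarith
  rw [tendsto_zero_iff_norm_tendsto_zero]
  simpa using h5.sqrt

/-- **Profile decomposition**: along an ultrafilter, normalized eigenvectors of `L_n` with
eigenvalues at most `b < δ` are asymptotically sums of the translates `(τ_n^j)⁻¹ w j` of
eigenvectors `w j` of `A + B^j`, all with the same limit eigenvalue. -/
theorem BoundedModel.exists_profile (M : BoundedModel A B R τ) (hA : Assumptions A B R τ)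
    (hN : 1 ≤ N) {δ : ℝ} (hδ : DiscreteBelow A δ) {b : ℝ} (hb : b < δ) {U : Ultrafilter ℕ}
    (hU : (U : Filter ℕ) ≤ atTop) {u : ℕ → X} {μ : ℕ → ℝ}
    (hev : ∀ᶠ n in U, ‖u n‖ = 1 ∧ μ n ≤ b ∧ u n ∈ eigenspace (Ln A B R τ n) (μ n)) :
    ∃ ν ≤ b, ∃ w : Fin N → X, (∀ j, w j ∈ eigenspace (A + B j) ν) ∧
      Tendsto (fun n => u n - ∑ j, (τ j n).symm (w j)) U (𝓝 0) := by
  obtain ⟨C, hC⟩ := M.exists_eigenvector_bound hA b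
  have hex : ∀ n, ∃ g, u n ∈ eigenspace (Ln A B R τ n) (μ n) → u n = M.G g ∧
      g + ∑ j, (τ j n).symm (M.K j (τ j n g)) + M.P n g = μ n • M.G g := by
    intro n
    by_cases h : u n ∈ eigenspace (Ln A B R τ n) (μ n)
    · obtain ⟨g, hg⟩ := (M.mem_graph_L n _).1 (mem_eigenspace_iff.1 h)
      obtain ⟨h1, h2⟩ := Prod.mk.inj hg
      exact ⟨g, fun _ => ⟨h1, by rw [← h2, ← h1]⟩⟩
    · exact ⟨0, fun h' => absurd h' h⟩
  choose g hg using hex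
  have hall : ∀ᶠ n in U, u n = M.G (g n) ∧
      g n + ∑ j, (τ j n).symm (M.K j (τ j n (g n))) + M.P n (g n) = μ n • M.G (g n) ∧
      |μ n| ≤ C ∧ ‖g n‖ ≤ C ∧ μ n ≤ b := by
    filter_upwards [hev, hU hC] with n h1 h2
    obtain ⟨h3, h4⟩ := hg n h1.2.2
    obtain ⟨h5, h6⟩ := h2 (g n) (μ n) (by rw [← h3]; exact h1.1) h1.2.1 h4
    exact ⟨h3, h4, h5, h6, h1.2.1⟩
  have hgb : ∀ᶠ n in U, ‖g n‖ ≤ C := hall.mono fun n h => h.2.2.2.1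
  have hτb : ∀ j, ∀ᶠ n in U, ‖τ j n (g n)‖ ≤ C := fun j => hgb.mono fun n h => by
    rwa [LinearIsometryEquiv.norm_map]
  obtain ⟨ν, hν⟩ := exists_tendsto_of_mem_Icc U (a := μ) (hall.mono fun n h => abs_le.1 h.2.2.1)
  have hνb : ν ≤ b := le_of_tendsto hν (hall.mono fun n h => h.2.2.2.2)
  choose γ hγ using fun j => exists_weakTendsto U (hτb j)
  have hK : ∀ j, Tendsto (fun n => M.K j (τ j n (g n)) - M.K j (γ j)) U (𝓝 0) := fun j => by
    simpa using ((hγ j).tendsto_of_isCompactOperator (hτb j) (M.compact j)).sub_const (M.K j (γ j))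
  have hP : Tendsto (fun n => M.P n (g n)) U (𝓝 0) := M.tendsto_remainder hU hgb
  -- the limit equation for the `j`-th profile
  have hlim : ∀ j, γ j + M.K j (γ j) = ν • M.G (γ j) := by
    intro j
    have hterm : ∀ l, WeakTendsto (U : Filter ℕ)
        (fun n => τ j n ((τ l n).symm (M.K l (τ l n (g n))))) (if l = j then M.K j (γ j) else 0) := by
      intro l
      have h1 : WeakTendsto (U : Filter ℕ)
          (fun n => τ j n ((τ l n).symm (M.K l (τ l n (g n)) - M.K l (γ l)))) 0 :=
        WeakTendsto.of_tendsto (tendsto_isometry_zero (fun n => τ j n)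
          (tendsto_isometry_zero (fun n => (τ l n).symm) (hK l)))
      have h2 : WeakTendsto (U : Filter ℕ) (fun n => τ j n ((τ l n).symm (M.K l (γ l))))
          (if l = j then M.K j (γ j) else 0) := by
        split_ifs with h
        · subst h
          simpa using WeakTendsto.of_tendsto (l := (U : Filter ℕ)) tendsto_const_nhds
        · exact fun v => (M.weak _ j l (Ne.symm h) v).mono_left hU
      simpa using h1.add h2
    have h1 := ((hγ j).add (WeakTendsto.sum Finset.univ fun l _ => hterm l)).add
      (WeakTendsto.of_tendsto (tendsto_isometry_zero (fun n => τ j n) hP))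
    have h2 := WeakTendsto.smul hν ((hγ j).clm M.G)
    rw [Finset.sum_ite_eq' Finset.univ j, if_pos (Finset.mem_univ _), add_zero] at h1
    refine h1.unique (h2.congr' (hall.mono fun n h => ?_))
    rw [← M.commutes, ← map_smul, ← h.2.1, map_add, map_add, map_sum]
  refine ⟨ν, hνb, fun j => M.G (γ j), fun j => ?_, ?_⟩
  · rw [mem_eigenspace_iff, M.mem_graph_B]
    exact ⟨γ j, by rw [hlim]⟩
  -- the remainder after subtraction of the profiles
  set h : ℕ → X := fun n => g n - ∑ j, (τ j n).symm (γ j) with hh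
  have hcomm : ∀ j n x, (τ j n).symm (M.G x) = M.G ((τ j n).symm x) := fun j n x => by
    rw [LinearIsometryEquiv.symm_apply_eq, M.commutes, LinearIsometryEquiv.apply_symm_apply]
  have hGh : ∀ n, M.G (h n) = M.G (g n) - ∑ j, (τ j n).symm (M.G (γ j)) := fun n => by
    simp only [hh, map_sub, map_sum, hcomm]
  have hd : Tendsto (fun n => h n - ν • M.G (h n)) U (𝓝 0) := by
    have hGg : Tendsto (fun n => (μ n - ν) • M.G (g n)) U (𝓝 0) := by
      have h1 : Tendsto (fun n => |μ n - ν| * (‖M.G‖ * C)) U (𝓝 0) := by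
        simpa using (hν.sub_const ν).abs.mul_const (‖M.G‖ * C)
      refine squeeze_zero_norm' ?_ h1
      filter_upwards [hgb] with n hn
      rw [norm_smul, Real.norm_eq_abs]
      gcongr
      exact (M.G.le_opNorm _).trans (by gcongr)
    have hsum : Tendsto (fun n => ∑ j, (τ j n).symm (M.K j (τ j n (g n)) - M.K j (γ j))) U
        (𝓝 0) := by
      simpa using tendsto_finsetSum Finset.univ fun j _ =>
        tendsto_isometry_zero (fun n => (τ j n).symm) (hK j)
    have h1 := (hGg.sub hsum).sub hP
    simp only [sub_zero] at h1
    refine h1.congr' (hall.mono fun n hn => ?_)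
    have h2 : g n = μ n • M.G (g n) - ∑ j, (τ j n).symm (M.K j (τ j n (g n))) - M.P n (g n) := by
      rw [← hn.2.1]; abel
    have h3 : ∑ j, (τ j n).symm (γ j) =
        ν • ∑ j, (τ j n).symm (M.G (γ j)) - ∑ j, (τ j n).symm (M.K j (γ j)) := by
      rw [Finset.smul_sum, ← Finset.sum_sub_distrib]
      refine Finset.sum_congr rfl fun j _ => ?_
      rw [← map_smul, ← map_sub, ← hlim, add_sub_cancel_right]
    simp only [hGh]
    simp only [hh, map_sub, Finset.sum_sub_distrib]
    linear_combination (norm := module) h3 - h2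
  let j₀ : Fin N := ⟨0, hN⟩
  have hweak : WeakTendsto (U : Filter ℕ) (fun n => τ j₀ n (h n)) 0 := by
    have h1 : ∀ l, WeakTendsto (U : Filter ℕ) (fun n => τ j₀ n ((τ l n).symm (γ l)))
        (if l = j₀ then γ j₀ else 0) := by
      intro l
      split_ifs with h
      · subst h
        simpa using WeakTendsto.of_tendsto (l := (U : Filter ℕ)) tendsto_const_nhds
      · exact fun v => (M.weak _ j₀ l (Ne.symm h) v).mono_left hU
    have h2 := (hγ j₀).sub (WeakTendsto.sum Finset.univ fun l _ => h1 l)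
    rw [Finset.sum_ite_eq' Finset.univ j₀, if_pos (Finset.mem_univ _), sub_self] at h2
    simpa only [hh, map_sub, map_sum] using h2
  have hfin := M.tendsto_zero_of_weak (graphSymmetric_of_isSelfAdjoint hA.selfAdjoint_A) hδ
    (hνb.trans_lt hb) (h := fun n => τ j₀ n (h n)) (l := (U : Filter ℕ))
    (C := C + ∑ j, ‖γ j‖) (hgb.mono fun n hn => ?_) ?_ ?_
  · have h1 := tendsto_isometry_zero (fun n => (τ j₀ n).symm) hfin
    refine h1.congr' (hall.mono fun n hn => ?_)
    rw [← M.commutes, LinearIsometryEquiv.symm_apply_apply, hGh, ← hn.1]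
  · rw [LinearIsometryEquiv.norm_map]
    refine (norm_sub_le _ _).trans (add_le_add hn (norm_sum_le_of_le _ fun j _ => ?_))
    rw [LinearIsometryEquiv.norm_map]
  · simpa using hweak.clm M.G
  · refine (tendsto_isometry_zero (fun n => τ j₀ n) hd).congr fun n => ?_
    rw [map_sub, map_smul, M.commutes]

end

/-! ### Comparison of eigenvalue counts -/

section

variable {X : Type*} [NormedAddCommGroup X] [InnerProductSpace ℝ X] {N : ℕ}
  {A : X →ₗ.[ℝ] X} {B : Fin N → X →ₗ.[ℝ] X} {R : ℕ → X →ₗ.[ℝ] X} {τ : Fin N → ℕ → X ≃ₗᵢ[ℝ] X}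

/-- Fewer linear conditions than unknowns have a nonzero solution. -/
theorem exists_ne_zero_of_card_lt {ι κ : Type*} [Fintype ι] [Fintype κ]
    (h : Fintype.card κ < Fintype.card ι) (a : κ → ι → ℝ) :
    ∃ c : ι → ℝ, c ≠ 0 ∧ ∀ k, ∑ i, c i * a k i = 0 := by
  have hlt : Module.finrank ℝ (κ → ℝ) < Module.finrank ℝ (ι → ℝ) := by simpa using h
  have hne := LinearMap.ker_ne_bot_of_finrank_lt (f := Matrix.mulVecLin (Matrix.of a)) hlt
  obtain ⟨c, hc, hc0⟩ := (Submodule.ne_bot_iff _).1 hne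
  refine ⟨c, hc0, fun k => ?_⟩
  have := congrFun (LinearMap.mem_ker.1 hc) k
  simpa [Matrix.mulVec, dotProduct, mul_comm] using this

/-- Families `w i = (w i j)_j` that are orthonormal in the direct sum `⊕ j, X` and whose `j`-th
components are eigenvectors of `L j` with eigenvalues in `S` number at most the total multiplicity
of these eigenvalues. -/
theorem card_le_sum_eigenvalueCount {L : Fin N → X →ₗ.[ℝ] X} (hsym : ∀ j, GraphSymmetric (L j))
    {δ : ℝ} (hL : ∀ j, DiscreteBelow (L j) δ) {S : Set ℝ} (hS : S ⊆ Set.Iio δ) {m : ℕ}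
    {w : Fin m → Fin N → X} {ν : Fin m → ℝ} (hw : ∀ i j, w i j ∈ eigenspace (L j) (ν i))
    (hν : ∀ i j, w i j ≠ 0 → ν i ∈ S)
    (hon : ∀ i k, ∑ j, inner ℝ (w i j) (w k j) = if i = k then 1 else 0) :
    m ≤ ∑ j, eigenvalueCount (L j) S := by
  choose e μ he hev hcompl using fun j => exists_orthonormal_eigenvectors (hsym j) (hL j) hS
  by_contra! hlt
  obtain ⟨c, hc0, hc⟩ := exists_ne_zero_of_card_lt (ι := Fin m)
    (κ := Σ j, Fin (eigenvalueCount (L j) S)) (by simpa using hlt)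
    (fun k i => inner ℝ (e k.1 k.2) (w i k.1))
  apply hc0
  have hzero : ∀ j, ∑ i, c i • w i j = 0 := by
    intro j
    have h1 : ∀ a, inner ℝ (e j a) (∑ i, c i • w i j) = 0 := fun a => by
      rw [inner_sum, ← hc ⟨j, a⟩]
      exact Finset.sum_congr rfl fun i _ => real_inner_smul_right _ _ _
    have h2 := hcompl j _ h1
    rw [← inner_self_eq_zero (𝕜 := ℝ)]
    nth_rewrite 1 [sum_inner]
    refine Finset.sum_eq_zero fun i _ => ?_
    rw [real_inner_smul_left]
    by_cases h : w i j = 0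
    · rw [h, inner_zero_left, mul_zero]
    · rw [h2 _ (hν i j h) _ (hw i j), mul_zero]
  funext k
  have h3 : ∑ j, inner ℝ (∑ i, c i • w i j) (w k j) = c k := by
    calc ∑ j, inner ℝ (∑ i, c i • w i j) (w k j)
        = ∑ i, c i * ∑ j, inner ℝ (w i j) (w k j) := by
          simp only [sum_inner, real_inner_smul_left, Finset.mul_sum]
          exact Finset.sum_comm
      _ = c k := by simp [hon]
  rw [← h3]
  exact Finset.sum_eq_zero fun j _ => by rw [hzero, inner_zero_left]

/-- A finite family of operators with discrete spectrum below `δ > 0` has a common punctured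
neighbourhood of `0` without eigenvalues. -/
theorem exists_spectral_gap {L : Fin N → X →ₗ.[ℝ] X} {δ : ℝ} (hδ : 0 < δ)
    (hL : ∀ j, DiscreteBelow (L j) δ) :
    ∃ r > 0, r < δ ∧ ∀ j, ∀ c, c ≠ 0 → |c| < r → eigenspace (L j) c = ⊥ := by
  have hev : ∀ᶠ c in 𝓝 (0 : ℝ), c < δ ∧ ∀ j, c ∉ (spec (L j) ∩ Set.Iio δ) \ {0} := by
    refine (gt_mem_nhds hδ).and (eventually_all.2 fun j => ?_)
    exact ((hL j).1.subset Set.sdiff_subset).isClosed.isOpen_compl.mem_nhds (by simp)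
  obtain ⟨r, hr, hball⟩ := Metric.eventually_nhds_iff.1 hev
  refine ⟨min r (δ / 2), by positivity, (min_le_right _ _).trans_lt (by linarith),
    fun j c hc0 hc => ?_⟩
  obtain ⟨h1, h2⟩ := hball (y := c) (by simpa using hc.trans_le (min_le_left _ _))
  refine eigenspace_eq_bot_of_mem_resolventSet ?_
  by_contra h
  exact h2 j ⟨⟨h, h1⟩, hc0⟩

variable [CompleteSpace X]

/-- For large `n`, the operator `L_n` has at most as many eigenvalues in `(-∞, ε]` as the
operators `A + B^j` have in `(-∞, 0]` together. -/
theorem BoundedModel.eventually_eigenvalueCount_le (M : BoundedModel A B R τ)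
    (hA : Assumptions A B R τ) (hN : 1 ≤ N) {δ : ℝ} (hδ : DiscreteBelow A δ)
    (hδB : ∀ j, DiscreteBelow (A + B j) δ) (hδL : ∀ n, DiscreteBelow (Ln A B R τ n) δ)
    {ε : ℝ} (hε0 : 0 < ε) (hε : ε < δ)
    (hgap : ∀ j, ∀ c, 0 < c → c ≤ ε → eigenspace (A + B j) c = ⊥) :
    ∀ᶠ n in atTop, eigenvalueCount (Ln A B R τ n) (Set.Iic ε) ≤
      ∑ j, eigenvalueCount (A + B j) (Set.Iic 0) := by
  set D := ∑ j, eigenvalueCount (A + B j) (Set.Iic 0) with hD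
  by_contra hcon
  obtain ⟨U, hU, hUD⟩ := exists_ultrafilter_of_frequently (not_eventually.1 hcon)
  have hex : ∀ n, ∃ (u : Fin (D + 1) → X) (μ : Fin (D + 1) → ℝ),
      D + 1 ≤ eigenvalueCount (Ln A B R τ n) (Set.Iic ε) → Orthonormal ℝ u ∧
        ∀ i, μ i ≤ ε ∧ u i ∈ eigenspace (Ln A B R τ n) (μ i) := by
    intro n
    by_cases h : D + 1 ≤ eigenvalueCount (Ln A B R τ n) (Set.Iic ε)
    · obtain ⟨e, μ, he, hev, -⟩ := exists_orthonormal_eigenvectors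
        (graphSymmetric_of_isSelfAdjoint (hA.selfAdjoint_L n).1) (hδL n)
        (Set.Iic_subset_Iio.2 hε)
      exact ⟨e ∘ Fin.castLE h, μ ∘ Fin.castLE h, fun _ =>
        ⟨he.comp _ (Fin.castLE_injective h), fun i => hev _⟩⟩
    · exact ⟨0, 0, fun h' => absurd h' h⟩
  choose u μ hu using hex
  have hall : ∀ᶠ n in U, Orthonormal ℝ (u n) ∧
      ∀ i, μ n i ≤ ε ∧ u n i ∈ eigenspace (Ln A B R τ n) (μ n i) :=
    hUD.mono fun n hn => hu n (by omega)
  choose ν hνε w hw hlim using fun i => M.exists_profile hA hN hδ hε hU (u := fun n => u n i)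
    (μ := fun n => μ n i) (hall.mono fun n hn => ⟨hn.1.1 i, hn.2 i⟩)
  -- the profiles inherit the orthonormality of the eigenvectors, as different translates decouple
  have hgram : ∀ i k, ∑ j, inner ℝ (w i j) (w k j) = if i = k then (1 : ℝ) else 0 := by
    intro i k
    set s : Fin (D + 1) → ℕ → X := fun i n => ∑ j, (τ j n).symm (w i j) with hs
    have h1 : Tendsto (fun n => inner ℝ (s i n) (s k n)) U
        (𝓝 (∑ j, inner ℝ (w i j) (w k j))) := by
      have h2 : Tendsto (fun n => ∑ j, ∑ l, inner ℝ ((τ j n).symm (w i j)) ((τ l n).symm (w k l)))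
          U (𝓝 (∑ j, ∑ l, if j = l then inner ℝ (w i j) (w k l) else 0)) :=
        tendsto_finsetSum _ fun j _ => tendsto_finsetSum _ fun l _ =>
          (M.tendsto_inner_translates j l _ _).mono_left hU
      simp only [Finset.sum_ite_eq, Finset.mem_univ, if_true] at h2
      refine h2.congr fun n => ?_
      simp only [hs, sum_inner, inner_sum]
      exact Finset.sum_comm
    have hbd : ∀ k n, ‖s k n‖ ≤ ∑ j, ‖w k j‖ := fun k n => norm_sum_le_of_le _ fun j _ => by
      rw [LinearIsometryEquiv.norm_map]
    have h3 : Tendsto (fun n => inner ℝ (u n i) (u n k) - inner ℝ (s i n) (s k n)) U (𝓝 0) := by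
      have h4 : Tendsto (fun n => ‖u n i - s i n‖ * 1 + (∑ j, ‖w i j‖) * ‖u n k - s k n‖) U
          (𝓝 0) := by
        simpa using ((hlim i).norm.mul_const 1).add ((hlim k).norm.const_mul (∑ j, ‖w i j‖))
      refine squeeze_zero_norm' ?_ h4
      filter_upwards [hall] with n hn
      have e : inner ℝ (u n i) (u n k) - inner ℝ (s i n) (s k n) =
          inner ℝ (u n i - s i n) (u n k) + inner ℝ (s i n) (u n k - s k n) := by
        rw [inner_sub_left, inner_sub_right]; ring
      rw [e]
      refine (norm_add_le _ _).trans (add_le_add ?_ ?_)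
      · rw [← hn.1.1 k]; exact norm_inner_le_norm _ _
      · refine (norm_inner_le_norm _ _).trans ?_
        gcongr
        exact hbd i n
    have h5 : Tendsto (fun n => inner ℝ (u n i) (u n k)) U
        (𝓝 (∑ j, inner ℝ (w i j) (w k j))) := by
      simpa using h3.add h1
    refine tendsto_nhds_unique h5 (tendsto_const_nhds.congr' (hall.mono fun n hn => ?_))
    exact (orthonormal_iff_ite.1 hn.1 i k).symm
  have hle := card_le_sum_eigenvalueCount
    (fun j => graphSymmetric_of_isSelfAdjoint (hA.selfAdjoint_B j).1) hδB
    (S := Set.Iic 0) (Set.Iic_subset_Iio.2 (hε0.trans hε)) hw (fun i j h => ?_) hgram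
  · omega
  · by_contra hpos
    have := hw i j
    rw [hgap j _ (not_le.1 hpos) (hνε i), Submodule.mem_bot] at this
    exact h this

/-- For large `n`, the operator `L_n` has at least as many eigenvalues below `-c` as the operators
`A + B^j` have negative ones together, provided that the latter lie below `-2 c`. The test space
is spanned by the translates of the eigenvectors of the `A + B^j`. -/
theorem BoundedModel.eventually_le_eigenvalueCount (M : BoundedModel A B R τ)
    (hA : Assumptions A B R τ) {δ : ℝ} (hδ0 : 0 < δ)
    (hδB : ∀ j, DiscreteBelow (A + B j) δ) (hδL : ∀ n, DiscreteBelow (Ln A B R τ n) δ)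
    {c : ℝ} (hc : 0 < c) (hgap : ∀ j, ∀ d < 0, eigenspace (A + B j) d ≠ ⊥ → d ≤ -2 * c) :
    ∀ᶠ n in atTop, ∑ j, eigenvalueCount (A + B j) (Set.Iio 0) ≤
      eigenvalueCount (Ln A B R τ n) (Set.Iio (-c)) := by
  by_contra hcon
  obtain ⟨U, hU, hUD⟩ := exists_ultrafilter_of_frequently (not_eventually.1 hcon)
  choose φ lam hφ hev _ using fun j => exists_orthonormal_eigenvectors
    (graphSymmetric_of_isSelfAdjoint (hA.selfAdjoint_B j).1) (hδB j) (S := Set.Iio 0)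
    (Set.Iio_subset_Iio hδ0.le)
  let κ := Σ j, Fin (eigenvalueCount (A + B j) (Set.Iio 0))
  have hγex : ∀ k : κ, ∃ γ, φ k.1 k.2 = M.G γ ∧
      γ + M.K k.1 γ = lam k.1 k.2 • φ k.1 k.2 := by
    intro k
    obtain ⟨γ, hγ⟩ := (M.mem_graph_B k.1 _).1 (mem_eigenspace_iff.1 (hev k.1 k.2).2)
    obtain ⟨h1, h2⟩ := Prod.mk.inj hγ
    exact ⟨γ, h1, h2.symm⟩
  choose γ hφγ hγeq using hγex
  have hlam : ∀ k : κ, lam k.1 k.2 ≤ -2 * c := fun k => by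
    refine hgap k.1 _ (hev k.1 k.2).1 fun h => ?_
    have h1 := (hev k.1 k.2).2
    rw [h, Submodule.mem_bot] at h1
    have h2 := (hφ k.1).1 k.2
    rw [h1, norm_zero] at h2
    exact zero_ne_one h2
  set ψ : κ → ℕ → X := fun k n => (τ k.1 n).symm (φ k.1 k.2) with hψ
  set g : κ → ℕ → X := fun k n => (τ k.1 n).symm (γ k) with hg
  have hGg : ∀ k n, M.G (g k n) = ψ k n := fun k n => by
    rw [hψ, hg]
    simp only
    rw [LinearIsometryEquiv.eq_symm_apply, M.commutes, LinearIsometryEquiv.apply_symm_apply,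
      hφγ]
  set Lψ : κ → ℕ → X := fun k n =>
    g k n + ∑ j, (τ j n).symm (M.K j (τ j n (g k n))) + M.P n (g k n) with hLψ
  have hgraph : ∀ k n, (ψ k n, Lψ k n) ∈ (Ln A B R τ n).graph := fun k n =>
    (M.mem_graph_L n _).2 ⟨g k n, by rw [hGg]⟩
  -- the translates are approximate eigenvectors of `L_n`
  have happ : ∀ k, Tendsto (fun n => Lψ k n - lam k.1 k.2 • ψ k n) U (𝓝 0) := by
    intro k
    have hterm : ∀ l, Tendsto (fun n => (τ l n).symm (M.K l (τ l n (g k n))) -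
        if l = k.1 then (τ k.1 n).symm (M.K k.1 (γ k)) else 0) U (𝓝 0) := by
      intro l
      split_ifs with h
      · subst h
        simp [hg]
      · have h1 : WeakTendsto (U : Filter ℕ) (fun n => τ l n (g k n)) 0 := fun v =>
          (M.weak (γ k) l k.1 h v).mono_left hU
        have h2 := h1.tendsto_of_isCompactOperator (C := ‖γ k‖) (Eventually.of_forall fun n => by
          simp [hg]) (M.compact l)
        rw [map_zero] at h2
        simpa using tendsto_isometry_zero (fun n => (τ l n).symm) h2
    have h1 := (tendsto_finsetSum Finset.univ fun l _ => hterm l).add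
      (M.tendsto_remainder hU (g := g k) (C := ‖γ k‖) (Eventually.of_forall fun n => by
        simp [hg]))
    rw [Finset.sum_const_zero, add_zero] at h1
    refine h1.congr fun n => ?_
    have h2 : lam k.1 k.2 • ψ k n = g k n + (τ k.1 n).symm (M.K k.1 (γ k)) := by
      simp only [hψ, hg]
      rw [← map_smul, ← hγeq, map_add]
    rw [Finset.sum_sub_distrib, Finset.sum_ite_eq' Finset.univ k.1, if_pos (Finset.mem_univ _), h2]
    simp only [hLψ]
    abel
  have hψψ : ∀ k l : κ, Tendsto (fun n => inner ℝ (ψ k n) (ψ l n)) U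
      (𝓝 (if k = l then 1 else 0)) := by
    rintro ⟨j, a⟩ ⟨l, b⟩
    have h1 := (M.tendsto_inner_translates j l (φ j a) (φ l b)).mono_left hU
    convert h1 using 2
    by_cases h : j = l
    · subst h
      rw [if_pos rfl, orthonormal_iff_ite.1 (hφ j) a b]
      by_cases hab : a = b
      · rw [hab, if_pos rfl, if_pos rfl]
      · rw [if_neg hab]
        exact if_neg fun h' => hab (by cases h'; rfl)
    · rw [if_neg h, if_neg fun h' => h (congrArg Sigma.fst h')]
  have hLψψ : ∀ k l : κ, Tendsto (fun n => inner ℝ (Lψ k n) (ψ l n)) U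
      (𝓝 (if k = l then lam k.1 k.2 else 0)) := by
    intro k l
    have h1 : Tendsto (fun n => inner ℝ (Lψ k n - lam k.1 k.2 • ψ k n) (ψ l n)) U (𝓝 0) := by
      have h2 : Tendsto (fun n => ‖Lψ k n - lam k.1 k.2 • ψ k n‖ * ‖φ l.1 l.2‖) U (𝓝 0) := by
        simpa using (happ k).norm.mul_const ‖φ l.1 l.2‖
      refine squeeze_zero_norm (fun n => (norm_inner_le_norm _ _).trans_eq ?_) h2
      rw [show ‖ψ l n‖ = ‖φ l.1 l.2‖ from LinearIsometryEquiv.norm_map _ _]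
    have h3 := h1.add ((hψψ k l).const_mul (lam k.1 k.2))
    simp only [inner_sub_left, real_inner_smul_left, sub_add_cancel, mul_ite, mul_one, mul_zero,
      zero_add] at h3
    exact h3
  -- normalized combinations of the translates orthogonal to the low eigenvectors of `L_n`
  have hex : ∀ n, ∃ a : κ → ℝ, ¬ ∑ j, eigenvalueCount (A + B j) (Set.Iio 0) ≤
      eigenvalueCount (Ln A B R τ n) (Set.Iio (-c)) → ∑ k, a k ^ 2 = 1 ∧
        -c * ‖∑ k, a k • ψ k n‖ ^ 2 ≤ inner ℝ (∑ k, a k • Lψ k n) (∑ k, a k • ψ k n) := by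
    intro n
    by_cases h : ∑ j, eigenvalueCount (A + B j) (Set.Iio 0) ≤
      eigenvalueCount (Ln A B R τ n) (Set.Iio (-c))
    · exact ⟨0, fun h' => absurd h h'⟩
    have hsym := graphSymmetric_of_isSelfAdjoint (hA.selfAdjoint_L n).1
    obtain ⟨e, μ, -, -, hcompl⟩ := exists_orthonormal_eigenvectors hsym (hδL n)
      (S := Set.Iio (-c)) (Set.Iio_subset_Iio (by linarith))
    obtain ⟨a, ha0, ha⟩ := exists_ne_zero_of_card_lt (ι := κ)
      (κ := Fin (eigenvalueCount (Ln A B R τ n) (Set.Iio (-c)))) (by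
        simpa [κ] using h) (fun i k => inner ℝ (e i) (ψ k n))
    have hs : 0 < ∑ k, a k ^ 2 := by
      obtain ⟨k, hk⟩ := Function.ne_iff.1 ha0
      have hk' : a k ≠ 0 := hk
      exact Finset.sum_pos' (fun _ _ => sq_nonneg _) ⟨k, Finset.mem_univ _, by positivity⟩
    set t := (√(∑ k, a k ^ 2))⁻¹ with ht
    refine ⟨fun k => t * a k, fun _ => ⟨?_, ?_⟩⟩
    · simp only [mul_pow]
      rw [← Finset.mul_sum, ht, inv_pow, Real.sq_sqrt hs.le, inv_mul_cancel₀ hs.ne']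
    · have hmem : (∑ k, (t * a k) • ψ k n, ∑ k, (t * a k) • Lψ k n) ∈ (Ln A B R τ n).graph := by
        have := (Ln A B R τ n).graph.sum_mem (t := Finset.univ) fun (k : κ) _ =>
          (Ln A B R τ n).graph.smul_mem (t * a k) (hgraph k n)
        convert this using 1
        ext <;> simp [Prod.fst_sum, Prod.snd_sum]
      refine le_inner_of_orthogonal_eigenspaces hsym (hδL n) (by linarith) hmem
        fun d hd v hv => hcompl _ (fun i => ?_) d hd v hv
      rw [inner_sum]
      calc ∑ k, inner ℝ (e i) ((t * a k) • ψ k n) = t * ∑ k, a k * inner ℝ (e i) (ψ k n) := by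
            simp only [real_inner_smul_right, Finset.mul_sum, mul_assoc]
        _ = 0 := by rw [ha, mul_zero]
  choose a ha using hex
  have hall := hUD.mono fun n hn => ha n hn
  have hlima : ∀ k, ∃ b, Tendsto (fun n => a n k) U (𝓝 b) := fun k =>
    exists_tendsto_of_mem_Icc U (c := -1) (d := 1) (hall.mono fun n hn => by
      refine abs_le.1 (abs_le_one_iff_mul_self_le_one.2 ?_)
      rw [← sq, ← hn.1]
      exact Finset.single_le_sum (f := fun k => a n k ^ 2) (fun _ _ => sq_nonneg _)
        (Finset.mem_univ k))
  choose b hb using hlima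
  have hb1 : ∑ k, b k ^ 2 = 1 :=
    tendsto_nhds_unique (tendsto_finsetSum Finset.univ fun k _ => (hb k).pow 2)
      (tendsto_const_nhds.congr' (hall.mono fun n hn => hn.1.symm))
  have hlimL : Tendsto (fun n => inner ℝ (∑ k, a n k • Lψ k n) (∑ k, a n k • ψ k n)) U
      (𝓝 (∑ k, b k * (b k * lam k.1 k.2))) := by
    have h1 : Tendsto (fun n => ∑ k, ∑ l, a n k * (a n l * inner ℝ (Lψ k n) (ψ l n))) U
        (𝓝 (∑ k, ∑ l, b k * (b l * if k = l then lam k.1 k.2 else 0))) :=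
      tendsto_finsetSum _ fun k _ => tendsto_finsetSum _ fun l _ =>
        (hb k).mul ((hb l).mul (hLψψ k l))
    simp only [mul_ite, mul_zero, Finset.sum_ite_eq, Finset.mem_univ, if_true] at h1
    refine h1.congr fun n => ?_
    simp only [sum_inner, inner_sum, real_inner_smul_left, real_inner_smul_right]
    rw [Finset.sum_comm]
    exact Finset.sum_congr rfl fun k _ => Finset.sum_congr rfl fun l _ => by ring
  have hlimN : Tendsto (fun n => ‖∑ k, a n k • ψ k n‖ ^ 2) U (𝓝 1) := by
    have h1 : Tendsto (fun n => ∑ k, ∑ l, a n k * (a n l * inner ℝ (ψ k n) (ψ l n))) U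
        (𝓝 (∑ k, ∑ l, b k * (b l * if k = l then 1 else 0))) :=
      tendsto_finsetSum _ fun k _ => tendsto_finsetSum _ fun l _ =>
        (hb k).mul ((hb l).mul (hψψ k l))
    simp only [mul_ite, mul_zero, mul_one, Finset.sum_ite_eq, Finset.mem_univ, if_true, ← sq,
      hb1] at h1
    refine h1.congr fun n => ?_
    rw [← real_inner_self_eq_norm_sq]
    simp only [sum_inner, inner_sum, real_inner_smul_left, real_inner_smul_right]
    rw [Finset.sum_comm]
    exact Finset.sum_congr rfl fun k _ => Finset.sum_congr rfl fun l _ => by ring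
  have hfinal := le_of_tendsto_of_tendsto (hlimN.const_mul (-c)) hlimL
    (hall.mono fun n hn => hn.2)
  have hupper : ∑ k : κ, b k * (b k * lam k.1 k.2) ≤ -2 * c := by
    calc ∑ k : κ, b k * (b k * lam k.1 k.2) ≤ ∑ k : κ, b k ^ 2 * (-2 * c) := by
          refine Finset.sum_le_sum fun k _ => ?_
          rw [← mul_assoc, ← sq]
          exact mul_le_mul_of_nonneg_left (hlam k) (sq_nonneg _)
      _ = -2 * c := by rw [← Finset.sum_mul, hb1, one_mul]
  linarith

end

/-! ### The inertia -/

section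

variable {X : Type*} [NormedAddCommGroup X] [InnerProductSpace ℝ X]

theorem eigenvalueCount_Iic {L : X →ₗ.[ℝ] X} {δ ε c : ℝ} (hL : DiscreteBelow L δ) (hc : 0 < c)
    (hε0 : 0 < ε) (hε : ε < δ) : eigenvalueCount L (Set.Iic ε) =
      eigenvalueCount L (Set.Iio (-c)) + (eigenvalueCount L (Set.Ico (-c) 0) +
        (Module.finrank ℝ (ker L) + eigenvalueCount L (Set.Ioc 0 ε))) := by
  have h0 : eigenvalueCount L {0} = Module.finrank ℝ (ker L) := finsum_mem_singleton
  rw [← h0, ← eigenvalueCount_union hL, ← eigenvalueCount_union hL, ← eigenvalueCount_union hL]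
  · congr 1
    ext x
    simp only [Set.mem_Iic, Set.mem_union, Set.mem_Iio, Set.mem_Ico, Set.mem_singleton_iff,
      Set.mem_Ioc]
    grind
  all_goals first
    | (intro x hx
       simp only [Set.mem_union, Set.mem_Iio, Set.mem_Ico, Set.mem_singleton_iff,
         Set.mem_Ioc] at hx ⊢
       grind)
    | (rw [Set.disjoint_left]
       intro x hx
       simp only [Set.mem_union, Set.mem_Iio, Set.mem_Ico, Set.mem_singleton_iff,
         Set.mem_Ioc] at hx ⊢
       grind)

theorem eigenvalueCount_Iic_zero {L : X →ₗ.[ℝ] X} {δ : ℝ} (hL : DiscreteBelow L δ) (hδ : 0 < δ) :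
    eigenvalueCount L (Set.Iic 0) = (inertia L).1 + (inertia L).2 := by
  have h0 : eigenvalueCount L {0} = (inertia L).2 := finsum_mem_singleton
  have h1 : eigenvalueCount L (Set.Iio 0) = (inertia L).1 := rfl
  rw [← h0, ← h1, ← eigenvalueCount_union hL (Set.Iio_subset_Iio hδ.le) (by simpa using hδ)
    (by simp)]
  congr 1
  ext x
  simp [le_iff_lt_or_eq]

end

end IsoInertia

end

theorem corollary4p4 {X : Type*} [NormedAddCommGroup X] [InnerProductSpace ℝ X] [CompleteSpace X]
    {N : ℕ} (hN : 1 ≤ N) (A : X →ₗ.[ℝ] X) (B : Fin N → X →ₗ.[ℝ] X) (R : ℕ → X →ₗ.[ℝ] X)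
    (τ : Fin N → ℕ → X ≃ₗᵢ[ℝ] X) (hA : IsoInertia.Assumptions A B R τ)
    (nL : ℕ)
    (hker : ∀ n ≥ nL, ∑ j, Module.finrank ℝ (IsoInertia.ker (A + B j)) ≤
      Module.finrank ℝ (IsoInertia.ker (IsoInertia.Ln A B R τ n))) :
    (∃ n₀ ≥ nL, ∀ n ≥ n₀,
      IsoInertia.inertia (IsoInertia.Ln A B R τ n) = ∑ j, IsoInertia.inertia (A + B j)) ∧
    (∃ ε > 0, ∃ n₀ ≥ nL, ∀ n ≥ n₀, ∀ μ : ℝ,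
      IsoInertia.IsEigenvalue (IsoInertia.Ln A B R τ n) μ → μ ≠ 0 → ε ≤ |μ|) := by
  open IsoInertia in
  obtain ⟨M⟩ := exists_boundedModel hA
  obtain ⟨δ, hδ0, hδA, hδB, -, hδL⟩ := hA.discrete
  obtain ⟨r, hr, hrδ, hgap⟩ := exists_spectral_gap hδ0 hδB
  -- the negative eigenvalues of the `A + B^j` are then at most `-3 ε ≤ -2 ε`
  set ε := r / 3 with hε
  have hε0 : 0 < ε := by positivity
  have hεδ : ε < δ := by linarith
  have hup := M.eventually_eigenvalueCount_le hA hN hδA hδB hδL hε0 hεδ fun j c hc0 hc =>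
    hgap j c hc0.ne' (by rw [abs_of_pos hc0]; linarith)
  have hlow := M.eventually_le_eigenvalueCount hA hδ0 hδB hδL hε0 fun j d hd hne => by
    by_contra! h
    exact hne (hgap j d hd.ne (by rw [abs_of_neg hd]; linarith))
  obtain ⟨n₁, hn₁⟩ := eventually_atTop.1 (hup.and hlow)
  have hcount : ∀ n ≥ max n₁ nL, inertia (Ln A B R τ n) = ∑ j, inertia (A + B j) ∧
      eigenvalueCount (Ln A B R τ n) (Set.Ico (-ε) 0) = 0 ∧
      eigenvalueCount (Ln A B R τ n) (Set.Ioc 0 ε) = 0 := by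
    intro n hn
    obtain ⟨h1, h2⟩ := hn₁ n ((le_max_left _ _).trans hn)
    have h3 : ∑ j, (inertia (A + B j)).2 ≤ Module.finrank ℝ (ker (Ln A B R τ n)) :=
      hker n ((le_max_right _ _).trans hn)
    have h4 : ∑ j, eigenvalueCount (A + B j) (Set.Iic 0) =
        ∑ j, (inertia (A + B j)).1 + ∑ j, (inertia (A + B j)).2 := by
      rw [← Finset.sum_add_distrib]
      exact Finset.sum_congr rfl fun j _ => eigenvalueCount_Iic_zero (hδB j) hδ0
    have h5 : ∑ j, (inertia (A + B j)).1 ≤ eigenvalueCount (Ln A B R τ n) (Set.Iio (-ε)) := h2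
    rw [eigenvalueCount_Iic (hδL n) hε0 hε0 hεδ, h4] at h1
    have h6 : (inertia (Ln A B R τ n)).1 = eigenvalueCount (Ln A B R τ n) (Set.Iio (-ε)) +
        eigenvalueCount (Ln A B R τ n) (Set.Ico (-ε) 0) := by
      rw [← eigenvalueCount_union (hδL n) (Set.Iio_subset_Iio (by linarith))
        (fun x hx => hx.2.trans hδ0), Set.Iio_union_Ico_eq_Iio (by linarith)]
      · rfl
      · exact Set.disjoint_left.2 fun x hx hx' => absurd hx'.1 (not_le.2 hx)
    have h7 : (inertia (Ln A B R τ n)).2 = Module.finrank ℝ (ker (Ln A B R τ n)) := rfl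
    refine ⟨Prod.ext ?_ ?_, by omega, by omega⟩
    · rw [Prod.fst_sum]; omega
    · rw [Prod.snd_sum]; omega
  refine ⟨⟨max n₁ nL, le_max_right _ _, fun n hn => (hcount n hn).1⟩,
    ε, hε0, max n₁ nL, le_max_right _ _, fun n hn μ hμ hμ0 => ?_⟩
  obtain ⟨-, h1, h2⟩ := hcount n hn
  by_contra! hlt
  obtain ⟨h3, h4⟩ := abs_lt.1 hlt
  rcases lt_or_gt_of_ne hμ0 with h | h
  · exact (eigenvalueCount_pos (hδL n) (S := Set.Ico (-ε) 0)
      (fun x hx => hx.2.trans hδ0) ⟨h3.le, h⟩ hμ).ne' h1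
  · exact (eigenvalueCount_pos (hδL n) (S := Set.Ioc 0 ε)
      (fun x hx => hx.2.trans_lt hεδ) ⟨h, h4.le⟩ hμ).ne' h2
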